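/- **Setting.** Let $X$ be a locally compact, paracompact Hausdorff space. Locally convex spaces are complex and Hausdorff, and $\mathcal L(E,F)$ is the space of continuous linear maps. A *locally convex sheaf* $E$ on $X$ is a sheaf of locally convex spaces $E(U)$ ($U\subseteq X$ open) with continuous linear restriction maps $\rho_{V,U}$ such that, for every open covering $(U_i)_i$ of an open $U$, the topology of $E(U)$ is the projective topology with respect to the maps $\rho_{U_i,U}$; morphisms of locally convex sheaves consist of continuous linear maps. A *test pair of sheaves* $(E,F)$ consists of locally convex sheaves such that $F$ is a subsheaf of $E$, each $F(U)$ has a topology finer than the one induced by $E(U)$, and for every open $U$ and every open covering $(U_i)_i$ of $U$ there is a partition of unity $(\eta^i)_i\subset\operatorname{Hom}(E|_U,E|_U)$ subordinate to $(U_i)_i$ (that is, the supports of the $\eta^i$ form a locally finite family, $\operatorname{supp}\eta^i\subseteq U_i$, and $\sum_i\eta^i=\mathrm{id}$) with $\eta^i|_F\in\operatorname{Hom}(F|_U,F|_U)$ for all $i$. Write $V\Subset U$ if $\overline V$ is compact and contained in $U$. Let $I=(0,1]$ and let $\mathcal S=(\mathcal A,\mathcal I)$ be an admissible pair of scales, that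 is, $\mathcal A,\mathcal I\subseteq[0,\infty)^I$ and, with $O$ understood for $\varepsilon\to0^+$: for all $\lambda,\mu\in\mathcal A$ there are $\nu,\nu'\in\mathcal A$ with $\lambda+\mu=O(\nu)$ and $\lambda\mu=O(\nu')$; some $\lambda\in\mathcal A$ has $\liminf_{\varepsilon\to0^+}\lambda_\varepsilon>0$; for all $\lambda\in\mathcal I$ there are $\mu,\nu,\mu',\nu'\in\mathcal I$ with $\mu+\nu=O(\lambda)$ and $\mu'\nu'=O(\lambda)$; some $\lambda\in\mathcal I$ tends to $0$; for all $\lambda\in\mathcal I$, $\mu\in\mathcal A$ there is $\nu\in\mathcal I$ with $\mu\nu=O(\lambda)$; and there are $\lambda\in\mathcal A$, $\mu\in\mathcal I$ with $\mu=O(\lambda)$. For $U$ open let $\mathrm{RO}(U)=\mathcal L(E(U),F(U))$ with the topology of bounded convergence; a subscript $\sigma$ on $\mathcal L$ denotes the topology of pointwise convergence. A net $(\Phi_\varepsilon)_\varepsilon\in\mathrm{RO}(U)^I$ is *localizing* if for all open $V\Subset V_0\Subset U$ and all sufficiently small $\varepsilon$ we have, for all $u\in E(U)$, that $\rho_{V_0,U}(u)=0$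 implies $\rho_{V,U}(\Phi_\varepsilon(u))=0$. $\mathrm{TO}_{\rm loc}(U)$ is the set of localizing nets such that (1) for every continuous seminorm $p$ on $\mathcal L_\sigma(E(U),F(U))$ there is $\lambda\in\mathcal A$ with $p(\Phi_\varepsilon)=O(\lambda_\varepsilon)$; (2) $p(\Phi_\varepsilon|_{F(U)}-\mathrm{id})=O(\lambda_\varepsilon)$ for every continuous seminorm $p$ on $\mathcal L_\sigma(F(U),F(U))$ and every $\lambda\in\mathcal I$; (3) $\Phi_\varepsilon\to\mathrm{id}$ in $\mathcal L_\sigma(E(U),E(U))$. $\mathrm{TO}^0_{\rm loc}(U)$ is defined in the same way with $\mathrm{id}$ replaced by $0$ in (2) and (3). Assume that $\mathrm{TO}_{\rm loc}(U)\neq\emptyset$ for every open $U\subseteq X$. Let $\mathcal E_{\rm loc}(U)$ be the space of maps $R\colon\mathrm{RO}(U)\to F(U)$ that are smooth in the sense of convenient calculus (they map smooth curves to smooth curves) and *local*: for every open $V\subseteq U$, $\rho_{V,U}\circ\Phi_1=\rho_{V,U}\circ\Phi_2$ implies $\rho_{V,U}(R(\Phi_1))=\rho_{V,U}(R(\Phi_2))$.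 Such an $R$ is *moderate* (resp. *negligible*) if for all continuous seminorms $p$ on $F(U)$, all $l\in\mathbb N$, all $(\Phi_\varepsilon)_\varepsilon\in\mathrm{TO}_{\rm loc}(U)$ and all $(\Psi_{1,\varepsilon})_\varepsilon,\dots,(\Psi_{l,\varepsilon})_\varepsilon\in\mathrm{TO}^0_{\rm loc}(U)$ one has $p(\mathrm d^lR(\Phi_\varepsilon)(\Psi_{1,\varepsilon},\dots,\Psi_{l,\varepsilon}))=O(\lambda_\varepsilon)$ for some $\lambda\in\mathcal A$ (resp. for all $\lambda\in\mathcal I$). Let $\mathcal G_{\rm loc}(U)$ be the quotient of the space of moderate elements of $\mathcal E_{\rm loc}(U)$ by the space of negligible ones, and let $\sigma_U\colon F(U)\to\mathcal G_{\rm loc}(U)$ send $\varphi$ to the class of the constant map $\Phi\mapsto\varphi$. For open $V\subseteq U$ and $R\in\mathcal E_{\rm loc}(U)$ let $\rho^{\mathcal E}_{V,U}(R)\in\mathcal E_{\rm loc}(V)$ be determined by the requirement that $\rho_{W,V}(\rho^{\mathcal E}_{V,U}(R)(\Phi))=\rho_{W,U}(R(\Phi'))$ whenever $W\Subset V$, $\Phi\in\mathrm{RO}(V)$,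 $\Phi'\in\mathrm{RO}(U)$ and $\rho_{W,V}\circ\Phi\circ\rho_{V,U}=\rho_{W,U}\circ\Phi'$. **Statement.** For every open $V\subseteq U$ and $R\in\mathcal E_{\rm loc}(U)$ there is exactly one such $\rho^{\mathcal E}_{V,U}(R)$; the maps $[R]\mapsto[\rho^{\mathcal E}_{V,U}(R)]$ are well defined, and with them $\mathcal G_{\rm loc}$ is a sheaf of vector spaces on $X$. Moreover: 1. For every open $U\subseteq X$ the sheaf $\mathcal G_{\rm loc}|_U$ is fine: for disjoint closed subsets $A,B$ of $U$ there is an endomorphism of $\mathcal G_{\rm loc}|_U$ that is the identity on an open neighbourhood of $A$ and zero on an open neighbourhood of $B$; and for every open covering of $U$ there is a subordinate partition of unity in $\operatorname{Hom}(\mathcal G_{\rm loc}|_U,\mathcal G_{\rm loc}|_U)$. Every $T\in\operatorname{Hom}(F|_U,F|_U)$ induces an endomorphism of $\mathcal G_{\rm loc}|_U$ by $[R]\mapsto[T_V\circ R]$ for $V\subseteq U$ open; it extends $T$ in the sense that $\sigma_V(\varphi)\mapsto\sigma_V(T_V\varphi)$, and it is the identity (resp. zero) on every open $W\subseteq U$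 on which $T$ is the identity (resp. zero). 2. $\sigma\colon F\to\mathcal G_{\rm loc}$ is an injective morphism of sheaves of vector spaces. If $F$ is a locally convex sheaf of algebras (associative, commutative, with jointly continuous multiplications that commute with restriction), then $\mathcal G_{\rm loc}$ is a sheaf of (associative, commutative) algebras with the multiplication $[R_1]\cdot[R_2]=[R_1\cdot R_2]$, where $(R_1\cdot R_2)(\Phi)=R_1(\Phi)\cdot R_2(\Phi)$, and $\sigma$ is a homomorphism of sheaves of algebras; if $e$ is a unit of $F(U)$, then $\sigma_U(e)$ is a unit of $\mathcal G_{\rm loc}(U)$. -/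

import Mathlib

open Filter Topology TopologicalSpace Set Asymptotics
open scoped NNReal ENNReal

universe u v w

noncomputable section

namespace NonlinearExtension

/-! ## Asymptotic scales -/

/-- The parameter set `(0, 1]`. -/
abbrev Param : Type := Set.Ioc (0 : ℝ) 1

/-- The filter `ε → 0⁺` on the parameter set. -/
def toZero : Filter Param := Filter.comap Subtype.val (𝓝[>] (0 : ℝ))

/-- `f_ε = O(g_ε)` as `ε → 0⁺`. -/
def BigO (f : Param → ℝ) (g : Param → ℝ≥0) : Prop :=
  f =O[toZero] fun ε => (g ε : ℝ)

/-- An admissible pair of scales `(𝒜, ℐ)`: an asymptotic growth scale `A`, an asymptotic decay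
scale `I`, and two compatibility conditions. -/
structure ScalePair where
  A : Set (Param → ℝ≥0)
  I : Set (Param → ℝ≥0)
  A_add : ∀ l ∈ A, ∀ m ∈ A, ∃ n ∈ A, BigO (fun ε => (l ε + m ε : ℝ)) n
  A_mul : ∀ l ∈ A, ∀ m ∈ A, ∃ n ∈ A, BigO (fun ε => (l ε * m ε : ℝ)) n
  A_liminf : ∃ l ∈ A, 0 < liminf (fun ε => (l ε : ℝ≥0∞)) toZero
  I_add : ∀ l ∈ I, ∃ m ∈ I, ∃ n ∈ I, BigO (fun ε => (m ε + n ε : ℝ)) l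
  I_mul : ∀ l ∈ I, ∃ m ∈ I, ∃ n ∈ I, BigO (fun ε => (m ε * n ε : ℝ)) l
  I_lim : ∃ l ∈ I, Tendsto l toZero (𝓝 0)
  A_mul_I : ∀ l ∈ I, ∀ m ∈ A, ∃ n ∈ I, BigO (fun ε => (m ε * n ε : ℝ)) l
  I_le_A : ∃ l ∈ A, ∃ m ∈ I, BigO (fun ε => (m ε : ℝ)) l

/-! ## Smooth maps between locally convex spaces, in the sense of convenient calculus -/

section Smooth

variable {E : Type v} [AddCommGroup E] [Module ℂ E] [TopologicalSpace E]
variable {F : Type w} [AddCommGroup F] [Module ℂ F] [TopologicalSpace F]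

/-- The curve `c : ℝ → F` has derivative `d` at `t`: the difference quotients converge to `d`. -/
def HasCurveDeriv (c : ℝ → F) (d : F) (t : ℝ) : Prop :=
  Tendsto (fun h : ℝ => ((h : ℂ)⁻¹) • (c (t + h) - c t)) (𝓝[≠] 0) (𝓝 d)

/-- The derivative of a curve (meaningful where it exists). -/
def curveDeriv (c : ℝ → F) (t : ℝ) : F :=
  limUnder (𝓝[≠] (0 : ℝ)) fun h : ℝ => ((h : ℂ)⁻¹) • (c (t + h) - c t)

/-- A smooth curve: derivatives of all orders exist everywhere. -/
def IsSmoothCurve (c : ℝ → F) : Prop :=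
  ∃ d : ℕ → ℝ → F, d 0 = c ∧ ∀ n t, HasCurveDeriv (d n) (d (n + 1) t) t

/-- A map is smooth (in the sense of convenient calculus) if it maps smooth curves to smooth
curves. -/
def IsSmoothMap (f : E → F) : Prop :=
  ∀ c : ℝ → E, IsSmoothCurve c → IsSmoothCurve fun t => f (c t)

/-- The `l`-th differential `dˡf(x)(v₁, …, v_l)` of a smooth map `f`. It is the symmetric `l`-linear
map whose value on the diagonal, at `(v, …, v)`, is the `l`-th derivative at `t = 0` of the curve
`t ↦ f(x + t v)`; it is written here by polarization,
`dˡf(x)(v₁, …, v_l) = (1 / l!) ∑_{S ⊆ {1, …, l}} (-1)^(l - |S|) (d/dt)ˡ|₀ f(x + t ∑_{i ∈ S} v_i)`. -/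
def differential (l : ℕ) (f : E → F) (x : E) (y : Fin l → E) : F :=
  ((l.factorial : ℂ)⁻¹) • ∑ S : Finset (Fin l), ((-1 : ℂ) ^ (l - S.card)) •
    (curveDeriv^[l] fun t : ℝ => f (x + (t : ℂ) • ∑ i ∈ S, y i)) 0

theorem iterate_curveDeriv_eq [T2Space F] {c : ℝ → F} {d : ℕ → ℝ → F} (h0 : d 0 = c)
    (hd : ∀ n t, HasCurveDeriv (d n) (d (n + 1) t) t) (n : ℕ) : curveDeriv^[n] c = d n := by
  induction n with
  | zero => simp [h0]
  | succ n ih =>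
    rw [Function.iterate_succ_apply', ih]
    funext t
    exact (hd n t).limUnder_eq

theorem isSmoothCurve_const (x : F) : IsSmoothCurve fun _ : ℝ => x := by
  refine ⟨fun n _ => if n = 0 then x else 0, by simp, fun n t => ?_⟩
  simp [HasCurveDeriv, tendsto_const_nhds]

theorem isSmoothCurve_line (x y : E) : IsSmoothCurve fun t : ℝ => x + (t : ℂ) • y := by
  refine ⟨fun n t => if n = 0 then x + (t : ℂ) • y else if n = 1 then y else 0, by simp, ?_⟩
  intro n t
  rcases n with _ | n
  · have : (fun h : ℝ => ((h : ℂ)⁻¹) • ((x + ((t + h : ℝ) : ℂ) • y) - (x + (t : ℂ) • y)))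
        =ᶠ[𝓝[≠] 0] fun _ => y := by
      filter_upwards [self_mem_nhdsWithin] with h hh
      have hh' : (h : ℂ) ≠ 0 := by simpa using hh
      have e : (x + ((t + h : ℝ) : ℂ) • y) - (x + (t : ℂ) • y) = (h : ℂ) • y := by
        push_cast
        rw [add_smul]
        abel
      rw [e, smul_smul, inv_mul_cancel₀ hh', one_smul]
    simpa [HasCurveDeriv] using tendsto_const_nhds.congr' this.symm
  · simp [HasCurveDeriv, tendsto_const_nhds]

theorem HasCurveDeriv.add [IsTopologicalAddGroup F] {c c' : ℝ → F} {d d' : F} {t : ℝ} (h : HasCurveDeriv c d t)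
    (h' : HasCurveDeriv c' d' t) : HasCurveDeriv (fun s => c s + c' s) (d + d') t := by
  refine (Tendsto.add h h').congr fun r => ?_
  rw [← smul_add, add_sub_add_comm]

theorem HasCurveDeriv.const_smul [ContinuousSMul ℂ F] {c : ℝ → F} {d : F} {t : ℝ} (a : ℂ) (h : HasCurveDeriv c d t) :
    HasCurveDeriv (fun s => a • c s) (a • d) t := by
  refine (Tendsto.const_smul h a).congr fun r => ?_
  rw [← smul_sub, smul_comm]

theorem IsSmoothCurve.add [IsTopologicalAddGroup F] {c c' : ℝ → F} (h : IsSmoothCurve c) (h' : IsSmoothCurve c') :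
    IsSmoothCurve fun t => c t + c' t := by
  obtain ⟨d, rfl, hd⟩ := h
  obtain ⟨d', rfl, hd'⟩ := h'
  exact ⟨fun n t => d n t + d' n t, rfl, fun n t => (hd n t).add (hd' n t)⟩

theorem IsSmoothCurve.const_smul [ContinuousSMul ℂ F] {c : ℝ → F} (a : ℂ) (h : IsSmoothCurve c) :
    IsSmoothCurve fun t => a • c t := by
  obtain ⟨d, rfl, hd⟩ := h
  exact ⟨fun n t => a • d n t, rfl, fun n t => (hd n t).const_smul a⟩

theorem differential_add [IsTopologicalAddGroup F] [T2Space F] {f g : E → F} (hf : IsSmoothMap f) (hg : IsSmoothMap g)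
    (l : ℕ) (x : E) (y : Fin l → E) :
    differential l (fun z => f z + g z) x y = differential l f x y + differential l g x y := by
  unfold differential
  rw [← smul_add, ← Finset.sum_add_distrib]
  congr 1
  refine Finset.sum_congr rfl fun S _ => ?_
  rw [← smul_add]
  congr 1
  obtain ⟨d, h0, hd⟩ := hf _ (isSmoothCurve_line x (∑ i ∈ S, y i))
  obtain ⟨d', h0', hd'⟩ := hg _ (isSmoothCurve_line x (∑ i ∈ S, y i))
  rw [iterate_curveDeriv_eq h0 hd, iterate_curveDeriv_eq h0' hd',
    iterate_curveDeriv_eq (d := fun n t => d n t + d' n t) (by simp [h0, h0'])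
      fun n t => (hd n t).add (hd' n t)]

theorem differential_const_smul [ContinuousSMul ℂ F] [T2Space F] {f : E → F}
    (hf : IsSmoothMap f) (a : ℂ)
    (l : ℕ) (x : E) (y : Fin l → E) :
    differential l (fun z => a • f z) x y = a • differential l f x y := by
  unfold differential
  rw [smul_comm (a : ℂ) ((l.factorial : ℂ)⁻¹) (_ : F), Finset.smul_sum (r := a)]
  congr 1
  refine Finset.sum_congr rfl fun S _ => ?_
  rw [smul_comm (a : ℂ) ((-1 : ℂ) ^ (l - S.card)) (_ : F)]
  congr 1
  obtain ⟨d, h0, hd⟩ := hf _ (isSmoothCurve_line x (∑ i ∈ S, y i))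
  rw [iterate_curveDeriv_eq h0 hd,
    iterate_curveDeriv_eq (d := fun n t => a • d n t) (by simp [h0])
      fun n t => (hd n t).const_smul a]

end Smooth

/-! ## Presheaves and sheaves of vector spaces, and locally convex sheaves -/

/-- `V ⋐ U`: the closure of `V` is compact and contained in `U`. -/
def RelCompact {X : Type u} [TopologicalSpace X] (V U : Opens X) : Prop :=
  IsCompact (closure (V : Set X)) ∧ closure (V : Set X) ⊆ U

/-- A presheaf of complex vector spaces on `X`. -/
structure VPresheaf (X : Type u) [TopologicalSpace X] where
  obj : Opens X → Type v
  [addCommGroup : ∀ U, AddCommGroup (obj U)]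
  [module : ∀ U, Module ℂ (obj U)]
  /-- The restriction maps. -/
  res : ∀ {U V : Opens X}, V ≤ U → obj U →ₗ[ℂ] obj V
  res_self : ∀ (U : Opens X) (u : obj U), res (le_refl U) u = u
  res_res : ∀ {U V W : Opens X} (hWV : W ≤ V) (hVU : V ≤ U) (u : obj U),
    res hWV (res hVU u) = res (hWV.trans hVU) u

attribute [instance] VPresheaf.addCommGroup VPresheaf.module

namespace VPresheaf

variable {X : Type u} [TopologicalSpace X]

/-- The sheaf property: uniqueness and existence of gluings over open coverings. -/
def IsSheaf (P : VPresheaf.{u, v} X) : Prop :=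
  ∀ (U : Opens X) (ι : Type u) (c : ι → Opens X) (hc : ∀ i, c i ≤ U), U ≤ ⨆ i, c i →
    (∀ u : P.obj U, (∀ i, P.res (hc i) u = 0) → u = 0) ∧
    (∀ s : ∀ i, P.obj (c i),
      (∀ i j, P.res (inf_le_left : c i ⊓ c j ≤ c i) (s i)
        = P.res (inf_le_right : c i ⊓ c j ≤ c j) (s j)) →
      ∃ u : P.obj U, ∀ i, P.res (hc i) u = s i)

/-- Linear (pre)sheaf morphisms `P|_U → Q|_U`. -/
@[ext] structure Hom (P : VPresheaf.{u, v} X) (Q : VPresheaf.{u, w} X) (U : Opens X) where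
  app : ∀ V : Opens X, V ≤ U → P.obj V →ₗ[ℂ] Q.obj V
  app_res : ∀ {V W : Opens X} (hV : V ≤ U) (hW : W ≤ V) (u : P.obj V),
    Q.res hW (app V hV u) = app W (hW.trans hV) (P.res hW u)

namespace Hom

variable {P : VPresheaf.{u, v} X} {U : Opens X}

/-- The restriction of `μ` to the open subset `W` is zero. -/
def VanishesOn (μ : Hom P P U) (W : Opens X) : Prop :=
  ∀ (V : Opens X) (hV : V ≤ U), V ≤ W → ∀ u : P.obj V, μ.app V hV u = 0

/-- The restriction of `μ` to the open subset `W` is the identity. -/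
def IsIdOn (μ : Hom P P U) (W : Opens X) : Prop :=
  ∀ (V : Opens X) (hV : V ≤ U), V ≤ W → ∀ u : P.obj V, μ.app V hV u = u

/-- The support of `μ`: the complement in `U` of the union of the open sets on which it vanishes. -/
def support (μ : Hom P P U) : Set X :=
  {x | x ∈ U ∧ ∀ W : Opens X, W ≤ U → x ∈ W → ¬ μ.VanishesOn W}

/-- `(η i)` is a partition of unity on `P|_U` subordinate to the family `(c i)`. The sum of the
`η i` is a locally finite sum, evaluated on the open sets that meet finitely many supports. -/
structure IsPartitionOfUnity {ι : Type u} (c : ι → Opens X) (η : ι → Hom P P U) : Prop where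
  locallyFinite : ∀ x ∈ U, ∃ W : Opens X, x ∈ W ∧ W ≤ U ∧
    {i | ((η i).support ∩ (W : Set X)).Nonempty}.Finite
  support_subset : ∀ i, (η i).support ⊆ c i
  sum_eq : ∀ (V : Opens X) (hV : V ≤ U)
    (hfin : {i | ((η i).support ∩ (V : Set X)).Nonempty}.Finite) (u : P.obj V),
    ∑ i ∈ hfin.toFinset, (η i).app V hV u = u

end Hom

/-- `P|_U` is fine, in terms of cut-off morphisms: disjoint closed subsets of `U` are separated by
an endomorphism that is the identity near the first and zero near the second. -/
def IsFineOn (P : VPresheaf.{u, v} X) (U : Opens X) : Prop :=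
  ∀ A B : Set U, IsClosed A → IsClosed B → Disjoint A B →
    ∃ (μ : Hom P P U) (V W : Opens X), V ≤ U ∧ W ≤ U ∧
      Subtype.val '' A ⊆ (V : Set X) ∧ Subtype.val '' B ⊆ (W : Set X) ∧
      μ.IsIdOn V ∧ μ.VanishesOn W

/-- `P|_U` is fine, in terms of partitions of unity. -/
def HasPartitionsOfUnityOn (P : VPresheaf.{u, v} X) (U : Opens X) : Prop :=
  ∀ (ι : Type u) (c : ι → Opens X), (∀ i, c i ≤ U) → U ≤ ⨆ i, c i →
    ∃ η : ι → Hom P P U, Hom.IsPartitionOfUnity c η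

/-- The structure of a presheaf of (associative, commutative) algebras on `P`. -/
structure AlgebraStructure (P : VPresheaf.{u, v} X) where
  mul : ∀ U : Opens X, P.obj U →ₗ[ℂ] P.obj U →ₗ[ℂ] P.obj U
  mul_comm : ∀ U (a b : P.obj U), mul U a b = mul U b a
  mul_assoc : ∀ U (a b c : P.obj U), mul U (mul U a b) c = mul U a (mul U b c)
  res_mul : ∀ {U V : Opens X} (h : V ≤ U) (a b : P.obj U),
    P.res h (mul U a b) = mul V (P.res h a) (P.res h b)

end VPresheaf

/-- A sheaf of (Hausdorff) locally convex spaces with continuous restriction maps, such that the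
topology on sections over `U` is the projective topology for every open covering of `U`. -/
structure LCSheaf (X : Type u) [TopologicalSpace X] extends VPresheaf.{u, v} X where
  [top : ∀ U, TopologicalSpace (obj U)]
  [topAddGroup : ∀ U, IsTopologicalAddGroup (obj U)]
  [continuousSMul : ∀ U, ContinuousSMul ℂ (obj U)]
  [locallyConvex : ∀ U, LocallyConvexSpace ℝ (obj U)]
  [t2 : ∀ U, T2Space (obj U)]
  continuous_res : ∀ {U V : Opens X} (h : V ≤ U), Continuous (res h)
  isSheaf : toVPresheaf.IsSheaf
  projective : ∀ (U : Opens X) (ι : Type u) (c : ι → Opens X) (hc : ∀ i, c i ≤ U),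
    U ≤ ⨆ i, c i → top U = ⨅ i, TopologicalSpace.induced (res (hc i)) (top (c i))

attribute [instance] LCSheaf.top LCSheaf.topAddGroup LCSheaf.continuousSMul
  LCSheaf.locallyConvex LCSheaf.t2

namespace LCSheaf

variable {X : Type u} [TopologicalSpace X]

/-- Linear sheaf morphisms `E|_U → E|_U`; see `IsContinuous` for the topological condition. -/
abbrev EndOn (E : LCSheaf.{u, v} X) (U : Opens X) := VPresheaf.Hom E.toVPresheaf E.toVPresheaf U

/-- A morphism of locally convex sheaves consists of continuous maps. -/
def IsContinuous {E : LCSheaf.{u, v} X} {U : Opens X} (μ : E.EndOn U) : Prop :=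
  ∀ (V : Opens X) (hV : V ≤ U), Continuous (μ.app V hV)

/-- A locally convex sheaf of algebras: the multiplications are jointly continuous. -/
def IsJointlyContinuous {E : LCSheaf.{u, v} X} (a : E.toVPresheaf.AlgebraStructure) : Prop :=
  ∀ U : Opens X, Continuous fun p : E.obj U × E.obj U => a.mul U p.1 p.2

end LCSheaf

/-! ## Test pairs of sheaves -/

/-- A test pair of sheaves `(E, F)`: `F` is a subsheaf of `E` (through `incl`), each `F(U)` carries
a topology finer than that induced by `E(U)`, and for every open covering of an open set `U` there
is a subordinate partition of unity on `E|_U` by continuous morphisms that restrict to continuous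
morphisms of `F|_U`. -/
structure TestPair (X : Type u) [TopologicalSpace X] where
  E : LCSheaf.{u, v} X
  F : LCSheaf.{u, w} X
  incl : ∀ U : Opens X, F.obj U →L[ℂ] E.obj U
  incl_injective : ∀ U, Function.Injective (incl U)
  incl_res : ∀ {U V : Opens X} (h : V ≤ U) (φ : F.obj U),
    incl V (F.res h φ) = E.res h (incl U φ)
  exists_partition : ∀ (U : Opens X) (ι : Type u) (c : ι → Opens X),
    (∀ i, c i ≤ U) → U ≤ ⨆ i, c i →
    ∃ η : ι → E.EndOn U, VPresheaf.Hom.IsPartitionOfUnity c η ∧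
      (∀ i, LCSheaf.IsContinuous (η i)) ∧
      ∀ i, ∃ θ : F.EndOn U, LCSheaf.IsContinuous θ ∧
        ∀ (V : Opens X) (hV : V ≤ U) (φ : F.obj V),
          (η i).app V hV (incl V φ) = incl V (θ.app V hV φ)

namespace TestPair

variable {X : Type u} [TopologicalSpace X] (P : TestPair.{u, v, w} X)

/-- Regularization operators on `U`, with the topology of bounded convergence. -/
abbrev RO (U : Opens X) := P.E.obj U →L[ℂ] P.F.obj U

/-- Nets of regularization operators, indexed by `(0, 1]`. -/
abbrev Net (U : Opens X) := Param → P.RO U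

/-- Localizing nets. -/
def ROloc (U : Opens X) : Set (P.Net U) :=
  {Φ | ∀ (V V₀ : Opens X) (_ : RelCompact V V₀) (_ : RelCompact V₀ U) (h₀ : V₀ ≤ U) (h : V ≤ U),
    ∀ᶠ ε in toZero, ∀ u : P.E.obj U, P.E.res h₀ u = 0 → P.F.res h (Φ ε u) = 0}

/-- Test objects on `U` with respect to the pair of scales `S`; `E →Lₚₜ[ℂ] F` is the space of
continuous linear maps with the topology of pointwise convergence. -/
structure IsTestObject (S : ScalePair) {U : Opens X} (Φ : P.Net U) : Prop where
  moderate : ∀ p : Seminorm ℂ (P.E.obj U →Lₚₜ[ℂ] P.F.obj U), Continuous p →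
    ∃ l ∈ S.A, BigO (fun ε => p ((Φ ε).toPointwiseConvergenceCLM ℂ (RingHom.id ℂ) _ _)) l
  approx : ∀ p : Seminorm ℂ (P.F.obj U →Lₚₜ[ℂ] P.F.obj U), Continuous p → ∀ l ∈ S.I,
    BigO (fun ε => p (((Φ ε).comp (P.incl U) - ContinuousLinearMap.id ℂ
      (P.F.obj U)).toPointwiseConvergenceCLM ℂ (RingHom.id ℂ) _ _)) l
  tendsto : Tendsto (fun ε =>
      ((P.incl U).comp (Φ ε)).toPointwiseConvergenceCLM ℂ (RingHom.id ℂ) _ _) toZero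
    (𝓝 ((ContinuousLinearMap.id ℂ (P.E.obj U)).toPointwiseConvergenceCLM ℂ (RingHom.id ℂ) _ _))

/-- `0`-test objects on `U` with respect to the pair of scales `S`. -/
structure IsZeroTestObject (S : ScalePair) {U : Opens X} (Ψ : P.Net U) : Prop where
  moderate : ∀ p : Seminorm ℂ (P.E.obj U →Lₚₜ[ℂ] P.F.obj U), Continuous p →
    ∃ l ∈ S.A, BigO (fun ε => p ((Ψ ε).toPointwiseConvergenceCLM ℂ (RingHom.id ℂ) _ _)) l
  approx : ∀ p : Seminorm ℂ (P.F.obj U →Lₚₜ[ℂ] P.F.obj U), Continuous p → ∀ l ∈ S.I,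
    BigO (fun ε =>
      p (((Ψ ε).comp (P.incl U)).toPointwiseConvergenceCLM ℂ (RingHom.id ℂ) _ _)) l
  tendsto : Tendsto (fun ε =>
      ((P.incl U).comp (Ψ ε)).toPointwiseConvergenceCLM ℂ (RingHom.id ℂ) _ _) toZero (𝓝 0)

/-- Localizing test objects. -/
def TOloc (S : ScalePair) (U : Opens X) : Set (P.Net U) :=
  {Φ | P.IsTestObject S Φ ∧ Φ ∈ P.ROloc U}

/-- Localizing `0`-test objects. -/
def TOzloc (S : ScalePair) (U : Opens X) : Set (P.Net U) :=
  {Ψ | P.IsZeroTestObject S Ψ ∧ Ψ ∈ P.ROloc U}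

/-! ## The local basic space and the quotient construction -/

variable {P}

/-- The elements of the basic space on `U` are the smooth maps from `RO(U)` to `F(U)`; such a map
`R` is local if `R(Φ)|_V` only depends on `ρ_{V,U} ∘ Φ`. -/
def IsLocal {U : Opens X} (R : P.RO U → P.F.obj U) : Prop :=
  ∀ (V : Opens X) (h : V ≤ U) (Φ₁ Φ₂ : P.RO U),
    (∀ u, P.F.res h (Φ₁ u) = P.F.res h (Φ₂ u)) → P.F.res h (R Φ₁) = P.F.res h (R Φ₂)

/-- The space of local elements of the basic space on `U`. -/
structure IsBasicLocal {U : Opens X} (R : P.RO U → P.F.obj U) : Prop where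
  smooth : IsSmoothMap R
  isLocal : IsLocal R

/-- Moderate maps. -/
def IsModerate (S : ScalePair) {U : Opens X} (R : P.RO U → P.F.obj U) : Prop :=
  ∀ p : Seminorm ℂ (P.F.obj U), Continuous p → ∀ (l : ℕ), ∀ Φ ∈ P.TOloc S U,
    ∀ Ψ : Fin l → P.Net U, (∀ j, Ψ j ∈ P.TOzloc S U) →
      ∃ m ∈ S.A, BigO (fun ε => p (differential l R (Φ ε) fun j => Ψ j ε)) m

/-- Negligible maps. -/
def IsNegligible (S : ScalePair) {U : Opens X} (R : P.RO U → P.F.obj U) : Prop :=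
  ∀ p : Seminorm ℂ (P.F.obj U), Continuous p → ∀ (l : ℕ), ∀ Φ ∈ P.TOloc S U,
    ∀ Ψ : Fin l → P.Net U, (∀ j, Ψ j ∈ P.TOzloc S U) →
      ∀ m ∈ S.I, BigO (fun ε => p (differential l R (Φ ε) fun j => Ψ j ε)) m

theorem IsBasicLocal.zero {U : Opens X} :
    IsBasicLocal (fun _ => 0 : P.RO U → P.F.obj U) :=
  ⟨fun _ _ => isSmoothCurve_const _, fun _ _ _ _ _ => rfl⟩

theorem IsBasicLocal.const {U : Opens X} (φ : P.F.obj U) :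
    IsBasicLocal (fun _ => φ : P.RO U → P.F.obj U) :=
  ⟨fun _ _ => isSmoothCurve_const _, fun _ _ _ _ _ => rfl⟩

theorem IsBasicLocal.add {U : Opens X} {R R' : P.RO U → P.F.obj U} (h : IsBasicLocal R)
    (h' : IsBasicLocal R') : IsBasicLocal fun Φ => R Φ + R' Φ :=
  ⟨fun c hc => (h.smooth c hc).add (h'.smooth c hc), fun V hV Φ₁ Φ₂ hΦ => by
    rw [map_add, map_add, h.isLocal V hV Φ₁ Φ₂ hΦ, h'.isLocal V hV Φ₁ Φ₂ hΦ]⟩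

theorem IsBasicLocal.const_smul {U : Opens X} {R : P.RO U → P.F.obj U} (a : ℂ)
    (h : IsBasicLocal R) : IsBasicLocal fun Φ => a • R Φ :=
  ⟨fun c hc => (h.smooth c hc).const_smul a, fun V hV Φ₁ Φ₂ hΦ => by
    rw [map_smul, map_smul, h.isLocal V hV Φ₁ Φ₂ hΦ]⟩

theorem BigO_of_le_add {f g k : Param → ℝ} {m : Param → ℝ≥0} (hk0 : ∀ ε, 0 ≤ k ε)
    (hk : ∀ ε, k ε ≤ f ε + g ε) (hf : BigO f m) (hg : BigO g m) : BigO k m := by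
  refine IsBigO.trans (IsBigO.of_bound 1 (Eventually.of_forall fun ε => ?_))
    (IsBigO.add hf hg)
  rw [one_mul, Real.norm_of_nonneg (hk0 ε)]
  exact (hk ε).trans (le_abs_self _)

theorem IsModerate.const (S : ScalePair) {U : Opens X} (φ : P.F.obj U) :
    IsModerate S (fun _ => φ : P.RO U → P.F.obj U) := by
  intro p _ l Φ _ Ψ _
  obtain ⟨m, hm, hlim⟩ := S.A_liminf
  refine ⟨m, hm, ?_⟩
  obtain ⟨r, hr0, hr⟩ := exists_between hlim
  have hev : ∀ᶠ ε in toZero, r < (m ε : ℝ≥0∞) := eventually_lt_of_lt_liminf hr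
  have hrtop : r ≠ ∞ := hr.ne_top
  set C : ℝ := p (differential l (fun _ => φ : P.RO U → P.F.obj U) 0 0) with hC
  have hr' : 0 < r.toReal := ENNReal.toReal_pos hr0.ne' hrtop
  refine IsBigO.of_bound (C / r.toReal) ?_
  filter_upwards [hev] with ε hε
  have h1 : r.toReal ≤ (m ε : ℝ) := by
    have := ENNReal.toReal_mono (ENNReal.coe_ne_top (r := m ε)) hε.le
    simpa using this
  have hC0 : 0 ≤ C := apply_nonneg p _
  have h2 : p (differential l (fun _ => φ : P.RO U → P.F.obj U) (Φ ε) fun j => Ψ j ε) = C := rfl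
  rw [h2, Real.norm_of_nonneg hC0, Real.norm_of_nonneg (NNReal.coe_nonneg _), div_mul_eq_mul_div,
    le_div_iff₀ hr']
  exact mul_le_mul_of_nonneg_left h1 hC0

/-- The space of moderate local elements of the basic space on `U`. -/
def Mloc (P : TestPair.{u, v, w} X) (S : ScalePair) (U : Opens X) :
    Submodule ℂ (P.RO U → P.F.obj U) where
  carrier := {R | IsBasicLocal R ∧ IsModerate S R}
  zero_mem' := ⟨IsBasicLocal.zero, IsModerate.const S 0⟩
  add_mem' := by
    rintro R R' ⟨hR, hM⟩ ⟨hR', hM'⟩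
    refine ⟨hR.add hR', fun p hp l Φ hΦ Ψ hΨ => ?_⟩
    obtain ⟨m, hm, h⟩ := hM p hp l Φ hΦ Ψ hΨ
    obtain ⟨m', hm', h'⟩ := hM' p hp l Φ hΦ Ψ hΨ
    obtain ⟨n, hn, hmn⟩ := S.A_add m hm m' hm'
    refine ⟨n, hn, ?_⟩
    have key : ∀ k k' : Param → ℝ≥0, BigO (fun ε => (k ε : ℝ)) fun ε => k ε + k' ε := by
      intro k k'
      refine IsBigO.of_bound 1 (Eventually.of_forall fun ε => ?_)
      rw [one_mul, Real.norm_of_nonneg (NNReal.coe_nonneg _),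
        Real.norm_of_nonneg (NNReal.coe_nonneg _)]
      exact_mod_cast le_self_add
    have e1 : BigO (fun ε => (m ε : ℝ)) n := (key m m').trans (by simpa [BigO] using hmn)
    have e2 : BigO (fun ε => (m' ε : ℝ)) n :=
      (key m' m).trans (by simpa [BigO, add_comm] using hmn)
    refine BigO_of_le_add (fun ε => apply_nonneg p _) (fun ε => ?_) (IsBigO.trans h e1)
      (IsBigO.trans h' e2)
    have := differential_add hR.smooth hR'.smooth l (Φ ε) fun j => Ψ j ε
    exact (congrArg p this).le.trans (map_add_le_add p _ _)
  smul_mem' := by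
    rintro a R ⟨hR, hM⟩
    refine ⟨hR.const_smul a, fun p hp l Φ hΦ Ψ hΨ => ?_⟩
    obtain ⟨m, hm, h⟩ := hM p hp l Φ hΦ Ψ hΨ
    refine ⟨m, hm, ?_⟩
    refine IsBigO.congr_left (IsBigO.const_mul_left h ‖a‖) fun ε => ?_
    have := differential_const_smul hR.smooth a l (Φ ε) fun j => Ψ j ε
    exact ((congrArg p this).trans (map_smul_eq_mul p _ _)).symm

/-- The space of negligible local elements of the basic space on `U`. -/
def Nloc (P : TestPair.{u, v, w} X) (S : ScalePair) (U : Opens X) :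
    Submodule ℂ (P.RO U → P.F.obj U) where
  carrier := {R | IsBasicLocal R ∧ IsNegligible S R}
  zero_mem' := by
    refine ⟨IsBasicLocal.zero, fun p hp l Φ hΦ Ψ hΨ m hm => ?_⟩
    have := differential_const_smul (IsBasicLocal.zero (P := P) (U := U)).smooth 0 l
    refine IsBigO.congr_left (isBigO_zero _ _) fun ε => ?_
    have h := this (Φ ε) fun j => Ψ j ε
    simp only [smul_zero, zero_smul] at h
    exact ((congrArg p h).trans (map_zero p)).symm
  add_mem' := by
    rintro R R' ⟨hR, hM⟩ ⟨hR', hM'⟩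
    refine ⟨hR.add hR', fun p hp l Φ hΦ Ψ hΨ m hm => ?_⟩
    refine BigO_of_le_add (fun ε => apply_nonneg p _) (fun ε => ?_) (hM p hp l Φ hΦ Ψ hΨ m hm)
      (hM' p hp l Φ hΦ Ψ hΨ m hm)
    have := differential_add hR.smooth hR'.smooth l (Φ ε) fun j => Ψ j ε
    exact (congrArg p this).le.trans (map_add_le_add p _ _)
  smul_mem' := by
    rintro a R ⟨hR, hM⟩
    refine ⟨hR.const_smul a, fun p hp l Φ hΦ Ψ hΨ m hm => ?_⟩
    refine IsBigO.congr_left (IsBigO.const_mul_left (hM p hp l Φ hΦ Ψ hΨ m hm) ‖a‖) fun ε => ?_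
    have := differential_const_smul hR.smooth a l (Φ ε) fun j => Ψ j ε
    exact ((congrArg p this).trans (map_smul_eq_mul p _ _)).symm

/-- The space `𝒢_loc(U)`: moderate local elements modulo negligible local elements. -/
abbrev Gloc (P : TestPair.{u, v, w} X) (S : ScalePair) (U : Opens X) :=
  (P.Mloc S U) ⧸ (P.Nloc S U).submoduleOf (P.Mloc S U)

/-- The class `[R]` of a moderate local element `R`. -/
def cls {S : ScalePair} {U : Opens X} (R : P.Mloc S U) : P.Gloc S U :=
  ((P.Nloc S U).submoduleOf (P.Mloc S U)).mkQ R

/-- The embedding `σ_U : F(U) → 𝒢_loc(U)`, which sends `φ` to the class of the constant map `φ`. -/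
def sigma (P : TestPair.{u, v, w} X) (S : ScalePair) (U : Opens X) :
    P.F.obj U →ₗ[ℂ] P.Gloc S U :=
  ((P.Nloc S U).submoduleOf (P.Mloc S U)).mkQ.comp
    (LinearMap.codRestrict (P.Mloc S U) (LinearMap.pi fun _ => LinearMap.id)
      fun φ => ⟨IsBasicLocal.const φ, IsModerate.const S φ⟩)

/-- `R'` is the restriction `ρ^ℰ_{V,U}(R)` to `V` of the local element `R` on `U`: the values of `R'`
are determined by `R'(Φ)|_W = R(Φ')|_W` whenever `W ⋐ V` and
`ρ_{W,V} ∘ Φ ∘ ρ_{V,U} = ρ_{W,U} ∘ Φ'`. -/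
def IsRestriction {U V : Opens X} (h : V ≤ U) (R : P.RO U → P.F.obj U)
    (R' : P.RO V → P.F.obj V) : Prop :=
  ∀ (W : Opens X) (_ : RelCompact W V) (hW : W ≤ V) (Φ : P.RO V) (Φ' : P.RO U),
    (∀ u : P.E.obj U, P.F.res hW (Φ (P.E.res h u)) = P.F.res (hW.trans h) (Φ' u)) →
    P.F.res hW (R' Φ) = P.F.res (hW.trans h) (R Φ')

/-- The presheaf `𝒢_loc`: presheaf structures on `U ↦ 𝒢_loc(U)` whose restriction maps are given by
`[R] ↦ [ρ^ℰ_{V,U}(R)]`. (There is exactly one.) -/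
structure GlocPresheaf (P : TestPair.{u, v, w} X) (S : ScalePair) where
  res : ∀ {U V : Opens X}, V ≤ U → P.Gloc S U →ₗ[ℂ] P.Gloc S V
  res_self : ∀ (U : Opens X) (g : P.Gloc S U), res (le_refl U) g = g
  res_res : ∀ {U V W : Opens X} (hWV : W ≤ V) (hVU : V ≤ U) (g : P.Gloc S U),
    res hWV (res hVU g) = res (hWV.trans hVU) g
  res_mk : ∀ {U V : Opens X} (h : V ≤ U) (R : P.Mloc S U),
    ∃ R' : P.Mloc S V, IsRestriction h R.1 R'.1 ∧ res h (cls R) = cls R'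

namespace GlocPresheaf

variable {S : ScalePair}

/-- `𝒢_loc` as a presheaf of vector spaces. -/
def toVPresheaf (G : P.GlocPresheaf S) : VPresheaf.{u, max v w} X where
  obj U := P.Gloc S U
  res h := G.res h
  res_self := G.res_self
  res_res := G.res_res

end GlocPresheaf

end TestPair

end NonlinearExtension

end

/-!
By polarization, moderateness and negligibility only involve the directional derivatives of `R` at
test objects along `0`-test objects. Let `κ` and `χ` be cut-offs from partitions of unity that are
the identity on a part of `V`. A test object `Φ` on `U` yields one on `V`, namely
`Φ ↦ κ ∘ Φ ∘ χ + (id - κ) ∘ Φ₀`, where sections over `V` are first extended to `U` after cutting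
off and `Φ₀` is a fixed test object on `V`; the second summand restores the approximation of the
identity away from the locus where `κ` is the identity. Test objects on `V` yield test objects on
`U` in the same way. Being localizing, the transported and the original nets eventually agree on a
given relatively compact set, so locality makes both growth conditions local, and they are
inherited by `R' = ρ^ℰ(R)`.

For gluing, `R` on `V` is extended to `U` by cutting off the arguments of `Φ` and the values of
`R`; these extensions, cut off along a partition of unity, are summed locally finitely. Continuous
endomorphisms of `F` act on the values of `R` and preserve both growth conditions, so the partitions
of unity of `F` induce those of the quotient.
-/

noncomputable section

namespace NonlinearExtension

/-! ## Seminorms -/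

section Seminorms

theorem polynormableSpace_of_locallyConvexSpace_real {F : Type*} [AddCommGroup F] [Module ℂ F]
    [TopologicalSpace F] [IsTopologicalAddGroup F] [ContinuousSMul ℂ F] [LocallyConvexSpace ℝ F] :
    PolynormableSpace ℂ F := by
  open scoped ComplexOrder in
  have : ContinuousSMul ℝ F := IsScalarTower.continuousSMul ℂ
  have : LocallyConvexSpace ℂ F := by
    rw [locallyConvexSpace_iff_exists_convex_subset_zero]
    intro N hN
    obtain ⟨C, hC, hconv, hCN⟩ :=
      (locallyConvexSpace_iff_exists_convex_subset_zero ℝ F).1 inferInstance N hN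
    exact ⟨C, hC, convex_of_nonneg_surjective_algebraMap _
      (fun _ hr => RCLike.nonneg_iff_exists_ofReal.mp hr) hconv, hCN⟩
  infer_instance

variable {𝕜 : Type*} [RCLike 𝕜]
variable {F₁ : Type*} [AddCommGroup F₁] [Module 𝕜 F₁]
variable {F₂ : Type*} [AddCommGroup F₂] [Module 𝕜 F₂]
variable {G : Type*} [AddCommGroup G] [Module 𝕜 G]

theorem seminorm_le_mul_of_forall_lt_one {p q : Seminorm 𝕜 F₁} {C : ℝ}
    (h : ∀ x, q x < 1 → p x ≤ C) (x : F₁) : p x ≤ C * q x := by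
  have : 0 ≤ C := (apply_nonneg p 0).trans (h 0 (by simp))
  have scale : ∀ r > q x, p x ≤ C * r := fun r hr => by
    have hr0 : 0 < r := (apply_nonneg q x).trans_lt hr
    have map_inv_smul (s : Seminorm 𝕜 F₁) : s ((r⁻¹ : 𝕜) • x) = r⁻¹ * s x := by
      simp [map_smul_eq_mul, abs_of_pos hr0]
    have hp := h ((r⁻¹ : 𝕜) • x) (by rwa [map_inv_smul, inv_mul_lt_one₀ hr0])
    rwa [map_inv_smul, inv_mul_le_iff₀ hr0, mul_comm] at hp
  exact le_mul_of_forall_lt₀ fun c hc r hr =>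
    (scale r hr).trans (by gcongr; exact (apply_nonneg q x).trans hr.le)

theorem exists_continuous_seminorm_of_mem_nhds [TopologicalSpace F₁] [PolynormableSpace 𝕜 F₁]
    {N : Set F₁} (hN : N ∈ 𝓝 0) : ∃ q : Seminorm 𝕜 F₁, Continuous q ∧ ∀ x, q x < 1 → x ∈ N := by
  have hF₁ := PolynormableSpace.withSeminorms 𝕜 F₁
  have := hF₁.topologicalAddGroup
  obtain ⟨s, r, hr, hsN⟩ := (hF₁.mem_nhds_iff 0 N).1 hN
  refine ⟨r.toNNReal⁻¹ • s.sup fun q => q.1,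
    (Seminorm.continuous_finsetSup fun q _ => q.2).const_smul _, fun x hx => hsN ?_⟩
  rw [Seminorm.mem_ball_zero]
  have hx' : r⁻¹ * (s.sup fun q => q.1) x < 1 := by
    simpa [NNReal.smul_def, hr.le] using hx
  rwa [inv_mul_lt_one₀ hr] at hx'

theorem exists_seminorm_bilinear_le [TopologicalSpace F₁] [PolynormableSpace 𝕜 F₁]
    [TopologicalSpace F₂] [PolynormableSpace 𝕜 F₂] [TopologicalSpace G]
    (B : F₁ →ₗ[𝕜] F₂ →ₗ[𝕜] G) (hB : Continuous fun x : F₁ × F₂ => B x.1 x.2)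
    (p : Seminorm 𝕜 G) (hp : Continuous p) :
    ∃ (q₁ : Seminorm 𝕜 F₁) (q₂ : Seminorm 𝕜 F₂), Continuous q₁ ∧ Continuous q₂ ∧
      ∀ a b, p (B a b) ≤ q₁ a * q₂ b := by
  have hpB : {x : F₁ × F₂ | p (B x.1 x.2) < 1} ∈ 𝓝 (0, 0) :=
    (isOpen_Iio.preimage (hp.comp hB)).mem_nhds (by simp)
  obtain ⟨N₁, hN₁, N₂, hN₂, hN⟩ := mem_nhds_prod_iff.1 hpB
  obtain ⟨q₁, hq₁, hqN₁⟩ := exists_continuous_seminorm_of_mem_nhds (𝕜 := 𝕜) hN₁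
  obtain ⟨q₂, hq₂, hqN₂⟩ := exists_continuous_seminorm_of_mem_nhds (𝕜 := 𝕜) hN₂
  refine ⟨q₁, q₂, hq₁, hq₂, fun a b => ?_⟩
  refine seminorm_le_mul_of_forall_lt_one (p := p.comp (B a)) (fun b hb => ?_) b
  have := seminorm_le_mul_of_forall_lt_one (p := p.comp (B.flip b)) (C := 1) (q := q₁)
    (fun a ha => (hN (Set.mk_mem_prod (hqN₁ a ha) (hqN₂ b hb))).le) a
  rwa [one_mul] at this

end Seminorms

/-! ## Smooth curves and iterated directional derivatives -/

section Curves

variable {F : Type*} [AddCommGroup F] [Module ℂ F] [TopologicalSpace F]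
variable {G : Type*} [AddCommGroup G] [Module ℂ G] [TopologicalSpace G]

theorem HasCurveDeriv.map (L : F →L[ℂ] G) {c : ℝ → F} {d : F} {t : ℝ}
    (h : HasCurveDeriv c d t) : HasCurveDeriv (fun s => L (c s)) (L d) t := by
  refine ((L.continuous.tendsto d).comp h).congr fun r => ?_
  simp

theorem IsSmoothCurve.map (L : F →L[ℂ] G) {c : ℝ → F} (h : IsSmoothCurve c) :
    IsSmoothCurve fun s => L (c s) := by
  obtain ⟨d, rfl, hd⟩ := h
  exact ⟨fun n t => L (d n t), rfl, fun n t => (hd n t).map L⟩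

theorem map_iterate_curveDeriv [T2Space F] [T2Space G] (L : F →L[ℂ] G) {c : ℝ → F}
    (hc : IsSmoothCurve c) (n : ℕ) (t : ℝ) :
    L (curveDeriv^[n] c t) = curveDeriv^[n] (fun s => L (c s)) t := by
  obtain ⟨d, rfl, hd⟩ := hc
  rw [iterate_curveDeriv_eq rfl hd, iterate_curveDeriv_eq (d := fun n t => L (d n t)) rfl
    fun n t => (hd n t).map L]

theorem HasCurveDeriv.comp_const_mul [ContinuousConstSMul ℂ F] {c : ℝ → F} {d : F}
    {t m : ℝ} (h : HasCurveDeriv c d (m * t)) :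
    HasCurveDeriv (fun s => c (m * s)) ((m : ℂ) • d) t := by
  rcases eq_or_ne m 0 with rfl | hm
  · simp [HasCurveDeriv, tendsto_const_nhds]
  have hm' : (m : ℂ) ≠ 0 := by exact_mod_cast hm
  have mul_left : Tendsto (fun r : ℝ => m * r) (𝓝[≠] 0) (𝓝[≠] 0) := by
    refine tendsto_nhdsWithin_iff.2 ⟨?_, ?_⟩
    · simpa using ((continuous_const_mul m).tendsto 0).mono_left nhdsWithin_le_nhds
    · filter_upwards [self_mem_nhdsWithin] with r hr using mul_ne_zero hm hr
  refine ((h.comp mul_left).const_smul (m : ℂ)).congr fun r => ?_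
  simp only [Function.comp_apply, smul_smul, mul_add]
  rw [Complex.ofReal_mul, mul_inv, mul_inv_cancel_left₀ hm']

theorem HasCurveDeriv.tendsto [ContinuousAdd F] [ContinuousSMul ℂ F] {c : ℝ → F} {d : F}
    {t : ℝ} (h : HasCurveDeriv c d t) :
    Tendsto (fun r : ℝ => c (t + r)) (𝓝[≠] 0) (𝓝 (c t)) := by
  have ofReal : Tendsto (fun r : ℝ => (r : ℂ)) (𝓝[≠] 0) (𝓝 0) := by
    simpa using (Complex.continuous_ofReal.tendsto 0).mono_left nhdsWithin_le_nhds
  have lim := (ofReal.smul h).add_const (c t)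
  rw [zero_smul, zero_add] at lim
  refine lim.congr' ?_
  filter_upwards [self_mem_nhdsWithin] with r hr
  have hr' : (r : ℂ) ≠ 0 := by simpa using hr
  rw [smul_inv_smul₀ hr', sub_add_cancel]

theorem HasCurveDeriv.sum [ContinuousAdd F] {ι : Type*} (s : Finset ι) {c : ι → ℝ → F}
    {d : ι → F} {t : ℝ} (h : ∀ i ∈ s, HasCurveDeriv (c i) (d i) t) :
    HasCurveDeriv (fun r => ∑ i ∈ s, c i r) (∑ i ∈ s, d i) t := by
  refine (tendsto_finsetSum s h).congr fun r => ?_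
  rw [← Finset.smul_sum, Finset.sum_sub_distrib]

end Curves

section Leibniz

variable {F₁ : Type*} [AddCommGroup F₁] [Module ℂ F₁] [TopologicalSpace F₁]
variable {F₂ : Type*} [AddCommGroup F₂] [Module ℂ F₂] [TopologicalSpace F₂]
  [ContinuousAdd F₂] [ContinuousSMul ℂ F₂]
variable {G : Type*} [AddCommGroup G] [Module ℂ G] [TopologicalSpace G]
  [IsTopologicalAddGroup G]
variable {B : F₁ →ₗ[ℂ] F₂ →ₗ[ℂ] G}

theorem HasCurveDeriv.bilinear (hB : Continuous fun x : F₁ × F₂ => B x.1 x.2) {c₁ : ℝ → F₁}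
    {c₂ : ℝ → F₂} {d₁ : F₁} {d₂ : F₂} {t : ℝ} (h₁ : HasCurveDeriv c₁ d₁ t)
    (h₂ : HasCurveDeriv c₂ d₂ t) :
    HasCurveDeriv (fun s => B (c₁ s) (c₂ s)) (B (c₁ t) d₂ + B d₁ (c₂ t)) t := by
  have lim₂ : Tendsto (fun r : ℝ => B (c₁ t) ((r : ℂ)⁻¹ • (c₂ (t + r) - c₂ t))) (𝓝[≠] 0)
      (𝓝 (B (c₁ t) d₂)) :=
    (hB.tendsto (c₁ t, d₂)).comp (tendsto_const_nhds.prodMk_nhds h₂)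
  have lim₁ : Tendsto (fun r : ℝ => B ((r : ℂ)⁻¹ • (c₁ (t + r) - c₁ t)) (c₂ (t + r))) (𝓝[≠] 0)
      (𝓝 (B d₁ (c₂ t))) :=
    (hB.tendsto (d₁, c₂ t)).comp (Tendsto.prodMk_nhds h₁ h₂.tendsto)
  refine (lim₂.add lim₁).congr fun r => ?_
  simp only [map_smul, LinearMap.smul_apply, map_sub, LinearMap.sub_apply]
  rw [← smul_add]
  congr 1
  abel

theorem hasCurveDeriv_leibniz [ContinuousSMul ℂ G] (hB : Continuous fun x : F₁ × F₂ => B x.1 x.2)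
    {d₁ : ℕ → ℝ → F₁} {d₂ : ℕ → ℝ → F₂} (h₁ : ∀ n t, HasCurveDeriv (d₁ n) (d₁ (n + 1) t) t)
    (h₂ : ∀ n t, HasCurveDeriv (d₂ n) (d₂ (n + 1) t) t) (n : ℕ) (t : ℝ) :
    HasCurveDeriv
      (fun t => ∑ ij ∈ Finset.HasAntidiagonal.antidiagonal n,
        n.choose ij.1 • B (d₁ ij.1 t) (d₂ ij.2 t))
      (∑ ij ∈ Finset.HasAntidiagonal.antidiagonal (n + 1),
        (n + 1).choose ij.1 • B (d₁ ij.1 t) (d₂ ij.2 t)) t := by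
  rw [Finset.sum_antidiagonal_choose_succ_nsmul (fun i j => B (d₁ i t) (d₂ j t)),
    ← Finset.sum_add_distrib]
  refine HasCurveDeriv.sum _ fun ij hij => ?_
  have h := (HasCurveDeriv.bilinear hB (h₁ ij.1 t) (h₂ ij.2 t)).const_smul (n.choose ij.1 : ℂ)
  rw [← Nat.choose_symm_of_eq_add (Finset.HasAntidiagonal.mem_antidiagonal.1 hij).symm, ← smul_add]
  simpa only [Nat.cast_smul_eq_nsmul] using h

end Leibniz

section DirDeriv

variable {E : Type*} [AddCommGroup E] [Module ℂ E]
variable {F : Type*} [AddCommGroup F] [Module ℂ F] [TopologicalSpace F]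
variable {G : Type*} [AddCommGroup G] [Module ℂ G] [TopologicalSpace G]

/-- The iterated directional derivative `(d/dt)ˡ|₀ f (x + t v)`. Since `differential l f x` is
obtained from it by polarization, estimates are proved for `dirDeriv` only. -/
def dirDeriv (l : ℕ) (f : E → F) (x v : E) : F :=
  curveDeriv^[l] (fun t : ℝ => f (x + (t : ℂ) • v)) 0

theorem differential_eq_sum_dirDeriv (l : ℕ) (f : E → F) (x : E) (y : Fin l → E) :
    differential l f x y = ((l.factorial : ℂ)⁻¹) • ∑ S : Finset (Fin l),
      ((-1 : ℂ) ^ (l - S.card)) • dirDeriv l f x (∑ i ∈ S, y i) := rfl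

theorem dirDeriv_zero (f : E → F) (x v : E) : dirDeriv 0 f x v = f x := by
  simp [dirDeriv]

variable [TopologicalSpace E]

theorem IsSmoothMap.comp_clm {E' : Type*} [AddCommGroup E'] [Module ℂ E'] [TopologicalSpace E']
    {f : E → F} (hf : IsSmoothMap f) (L : E' →L[ℂ] E) : IsSmoothMap fun x => f (L x) :=
  fun _ hc => hf _ (hc.map L)

theorem IsSmoothMap.clm_comp {f : E → F} (L : F →L[ℂ] G) (hf : IsSmoothMap f) :
    IsSmoothMap fun x => L (f x) :=
  fun c hc => (hf c hc).map L

theorem dirDeriv_congr {E' : Type*} [AddCommGroup E'] [Module ℂ E'] [TopologicalSpace E']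
    {F' : Type*} [AddCommGroup F'] [Module ℂ F'] [TopologicalSpace F'] [T2Space F] [T2Space F']
    [T2Space G] {f : E → F} {f' : E' → F'} (hf : IsSmoothMap f) (hf' : IsSmoothMap f')
    (L : F →L[ℂ] G) (L' : F' →L[ℂ] G) {x v : E} {x' v' : E'}
    (h : ∀ t : ℝ, L (f (x + (t : ℂ) • v)) = L' (f' (x' + (t : ℂ) • v'))) (l : ℕ) :
    L (dirDeriv l f x v) = L' (dirDeriv l f' x' v') := by
  unfold dirDeriv
  rw [map_iterate_curveDeriv L (hf _ (isSmoothCurve_line x v)),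
    map_iterate_curveDeriv L' (hf' _ (isSmoothCurve_line x' v')), funext h]

theorem dirDeriv_smul [T2Space F] [ContinuousSMul ℂ F] {f : E → F} (hf : IsSmoothMap f) (l : ℕ)
    (x v : E) (m : ℝ) : dirDeriv l f x ((m : ℂ) • v) = (m : ℂ) ^ l • dirDeriv l f x v := by
  obtain ⟨d, h0, hd⟩ := hf _ (isSmoothCurve_line x v)
  have hdm (n : ℕ) (t : ℝ) : HasCurveDeriv (fun t => (m : ℂ) ^ n • d n (m * t))
      ((m : ℂ) ^ (n + 1) • d (n + 1) (m * t)) t := by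
    simpa only [smul_smul, ← pow_succ] using (hd n (m * t)).comp_const_mul.const_smul ((m : ℂ) ^ n)
  have h0m : (fun t => (m : ℂ) ^ 0 • d 0 (m * t)) = fun t : ℝ => f (x + (t : ℂ) • (m : ℂ) • v) := by
    funext t
    simp only [pow_zero, one_smul, h0, smul_smul, Complex.ofReal_mul, mul_comm]
  unfold dirDeriv
  rw [iterate_curveDeriv_eq h0 hd,
    iterate_curveDeriv_eq (d := fun n t => (m : ℂ) ^ n • d n (m * t)) h0m hdm]
  simp only [mul_zero]

theorem sum_neg_one_pow_mul_card_pow {R : Type*} [CommRing R] (l : ℕ) :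
    ∑ S : Finset (Fin l), (-1 : R) ^ (l - S.card) * (S.card : R) ^ l = l.factorial := by
  have sum_card := Finset.sum_powerset_apply_card
    (fun m => (-1 : R) ^ (l - m) * (m : R) ^ l) (x := (Finset.univ : Finset (Fin l)))
  rw [Finset.powerset_univ, Finset.card_univ, Fintype.card_fin] at sum_card
  have diff_pow := congrFun (fwdDiff_iter_eq_factorial (R := R) (n := l)) 0
  rw [fwdDiff_iter_eq_sum_shift] at diff_pow
  simp only [nsmul_eq_mul, mul_one, zero_add, Pi.natCast_apply] at diff_pow
  rw [sum_card, ← diff_pow]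
  refine Finset.sum_congr rfl fun m _ => ?_
  rw [zsmul_eq_mul, nsmul_eq_mul]
  push_cast
  ring

theorem differential_diag [T2Space F] [ContinuousSMul ℂ F] {f : E → F} (hf : IsSmoothMap f)
    (l : ℕ) (x v : E) : (differential l f x fun _ => v) = dirDeriv l f x v := by
  have term (S : Finset (Fin l)) : ((-1 : ℂ) ^ (l - S.card)) • dirDeriv l f x (∑ _i ∈ S, v)
      = ((-1 : ℂ) ^ (l - S.card) * (S.card : ℂ) ^ l) • dirDeriv l f x v := by
    have hv : ∑ _i ∈ S, v = ((S.card : ℝ) : ℂ) • v := by simp [Nat.cast_smul_eq_nsmul]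
    rw [hv, dirDeriv_smul hf, smul_smul, Complex.ofReal_natCast]
  rw [differential_eq_sum_dirDeriv]
  simp_rw [term]
  rw [← Finset.sum_smul, sum_neg_one_pow_mul_card_pow,
    inv_smul_smul₀ (by exact_mod_cast l.factorial_ne_zero)]

variable {F₁ : Type*} [AddCommGroup F₁] [Module ℂ F₁] [TopologicalSpace F₁]
variable {F₂ : Type*} [AddCommGroup F₂] [Module ℂ F₂] [TopologicalSpace F₂]
  [ContinuousAdd F₂] [ContinuousSMul ℂ F₂]
variable [IsTopologicalAddGroup G] [ContinuousSMul ℂ G]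
variable {B : F₁ →ₗ[ℂ] F₂ →ₗ[ℂ] G}

theorem IsSmoothMap.bilinear (hB : Continuous fun x : F₁ × F₂ => B x.1 x.2) {f : E → F₁}
    {g : E → F₂} (hf : IsSmoothMap f) (hg : IsSmoothMap g) :
    IsSmoothMap fun x => B (f x) (g x) := by
  intro c hc
  obtain ⟨d₁, h0₁, h₁⟩ := hf c hc
  obtain ⟨d₂, h0₂, h₂⟩ := hg c hc
  exact ⟨fun n t => ∑ ij ∈ Finset.HasAntidiagonal.antidiagonal n,
      n.choose ij.1 • B (d₁ ij.1 t) (d₂ ij.2 t),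
    by simp [h0₁, h0₂], hasCurveDeriv_leibniz hB h₁ h₂⟩

theorem dirDeriv_bilinear [T2Space F₁] [T2Space F₂] [T2Space G]
    (hB : Continuous fun x : F₁ × F₂ => B x.1 x.2) {f : E → F₁} {g : E → F₂}
    (hf : IsSmoothMap f) (hg : IsSmoothMap g) (l : ℕ) (x v : E) :
    dirDeriv l (fun x => B (f x) (g x)) x v = ∑ ij ∈ Finset.HasAntidiagonal.antidiagonal l,
      l.choose ij.1 • B (dirDeriv ij.1 f x v) (dirDeriv ij.2 g x v) := by
  obtain ⟨d₁, h0₁, h₁⟩ := hf _ (isSmoothCurve_line x v)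
  obtain ⟨d₂, h0₂, h₂⟩ := hg _ (isSmoothCurve_line x v)
  unfold dirDeriv
  rw [iterate_curveDeriv_eq (d := fun n t => ∑ ij ∈ Finset.HasAntidiagonal.antidiagonal n,
    n.choose ij.1 • B (d₁ ij.1 t) (d₂ ij.2 t)) (by simp [h0₁, h0₂])
    (hasCurveDeriv_leibniz hB h₁ h₂)]
  simp_rw [iterate_curveDeriv_eq h0₁ h₁, iterate_curveDeriv_eq h0₂ h₂]

end DirDeriv

/-! ## Sheaves of vector spaces -/

section OpenCoverings

variable {X : Type u} [TopologicalSpace X]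

theorem le_iSup_of_forall_mem {U : Opens X} {W : U → Opens X} (hW : ∀ x : U, x.1 ∈ W x) :
    U ≤ ⨆ x, W x :=
  fun x hx => Opens.mem_iSup.2 ⟨⟨x, hx⟩, hW ⟨x, hx⟩⟩

end OpenCoverings

namespace VPresheaf

variable {X : Type u} [TopologicalSpace X] {P : VPresheaf.{u, v} X} {U V W Z : Opens X}

theorem res_eq (P : VPresheaf.{u, v} X) (h : U ≤ U) (s : P.obj U) : P.res h s = s :=
  P.res_self U s

theorem res_congr (P : VPresheaf.{u, v} X) (hVU : V ≤ U) (hWV : W ≤ V) {a b : P.obj U}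
    (h : P.res hVU a = P.res hVU b) : P.res (hWV.trans hVU) a = P.res (hWV.trans hVU) b := by
  rw [← P.res_res hWV hVU, h, P.res_res]

theorem IsSheaf.eq_of_locally (hP : P.IsSheaf) {a b : P.obj U}
    (h : ∀ x ∈ U, ∃ (W : Opens X) (hW : W ≤ U), x ∈ W ∧ P.res hW a = P.res hW b) : a = b := by
  have h' (x : U) := h x x.2
  choose W hW hx heq using h'
  refine sub_eq_zero.1 ((hP U U W hW (le_iSup_of_forall_mem hx)).1 (a - b) fun x => ?_)
  rw [map_sub, heq, sub_self]

theorem IsSheaf.eq_of_sup (hP : P.IsSheaf) (hV : V ≤ U) (hZ : Z ≤ U) (hU : U ≤ V ⊔ Z)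
    {a b : P.obj U} (h₁ : P.res hV a = P.res hV b) (h₂ : P.res hZ a = P.res hZ b) : a = b :=
  hP.eq_of_locally fun _ hx => (hU hx).elim (fun h => ⟨V, hV, h, h₁⟩) fun h => ⟨Z, hZ, h, h₂⟩

theorem IsSheaf.exists_glue (hP : P.IsSheaf) (Q : ∀ W : Opens X, W ≤ U → P.obj W → Prop)
    (hcov : ∀ x ∈ U, ∃ (W : Opens X) (hW : W ≤ U) (s : P.obj W), x ∈ W ∧ Q W hW s)
    (hcoh : ∀ (W W' : Opens X) (hW : W ≤ U) (hW' : W' ≤ U) (s : P.obj W) (s' : P.obj W'),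
      Q W hW s → Q W' hW' s' →
        P.res (inf_le_left : W ⊓ W' ≤ W) s = P.res (inf_le_right : W ⊓ W' ≤ W') s') :
    ∃ a : P.obj U, ∀ (W : Opens X) (hW : W ≤ U) (s : P.obj W), Q W hW s → P.res hW a = s := by
  have hcov' (x : U) := hcov x x.2
  choose W hW s hx hQ using hcov'
  obtain ⟨a, ha⟩ := (hP U U W hW (le_iSup_of_forall_mem hx)).2 s fun i j =>
    hcoh _ _ (hW i) (hW j) _ _ (hQ i) (hQ j)
  refine ⟨a, fun V hV t ht => hP.eq_of_locally fun x hxV => ?_⟩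
  refine ⟨V ⊓ W ⟨x, hV hxV⟩, inf_le_left, ⟨hxV, hx _⟩, ?_⟩
  rw [hcoh _ _ hV (hW ⟨x, hV hxV⟩) _ _ ht (hQ _), ← ha, P.res_res, P.res_res]

theorem IsSheaf.exists_glue_sup (hP : P.IsSheaf) (hV : V ≤ U) (hZ : Z ≤ U) (hU : U ≤ V ⊔ Z)
    (a : P.obj V) (b : P.obj Z)
    (h : P.res (inf_le_left : V ⊓ Z ≤ V) a = P.res (inf_le_right : V ⊓ Z ≤ Z) b) :
    ∃ s : P.obj U, P.res hV s = a ∧ P.res hZ s = b := by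
  have hab {W : Opens X} (hWV : W ≤ V) (hWZ : W ≤ Z) : P.res hWV a = P.res hWZ b := by
    rw [← P.res_res (le_inf hWV hWZ) inf_le_left, h, P.res_res]
  obtain ⟨s, hs⟩ := hP.exists_glue (U := U)
    (fun W _ t => (∃ h : W ≤ V, t = P.res h a) ∨ ∃ h : W ≤ Z, t = P.res h b)
    (fun x hx => (hU hx).elim (fun h => ⟨V, hV, _, h, .inl ⟨le_rfl, rfl⟩⟩)
      fun h => ⟨Z, hZ, _, h, .inr ⟨le_rfl, rfl⟩⟩) (by
    rintro W W' - - _ _ (⟨h, rfl⟩ | ⟨h, rfl⟩) (⟨h', rfl⟩ | ⟨h', rfl⟩) <;>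
      simp only [P.res_res]
    exacts [hab _ _, (hab _ _).symm])
  exact ⟨s, hs V hV a (.inl ⟨le_rfl, (P.res_eq _ a).symm⟩),
    hs Z hZ b (.inr ⟨le_rfl, (P.res_eq _ b).symm⟩)⟩

/-! ## Endomorphisms and partitions of unity -/

namespace Hom

variable {μ : Hom P P U}

theorem VanishesOn.mono (h : μ.VanishesOn W) (hVW : V ≤ W) : μ.VanishesOn V :=
  fun O hO hOV => h O hO (hOV.trans hVW)

theorem VanishesOn.res_app (h : μ.VanishesOn Z) (hV : V ≤ U) (hWV : W ≤ V) (hWZ : W ≤ Z)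
    (a : P.obj V) : P.res hWV (μ.app V hV a) = 0 := by
  rw [μ.app_res, h _ _ hWZ]

theorem IsIdOn.res_app (h : μ.IsIdOn Z) (hV : V ≤ U) (hWV : W ≤ V) (hWZ : W ≤ Z)
    (a : P.obj V) : P.res hWV (μ.app V hV a) = P.res hWV a := by
  rw [μ.app_res, h _ _ hWZ]

/-- The complement in `U` of the support of `μ`: the largest open subset of `U` on which `μ`
vanishes. -/
def zeroLocus (μ : Hom P P U) : Opens X := sSup {W | W ≤ U ∧ μ.VanishesOn W}

/-- The largest open subset of `U` on which `μ` is the identity. -/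
def idLocus (μ : Hom P P U) : Opens X := sSup {W | W ≤ U ∧ μ.IsIdOn W}

theorem zeroLocus_le (μ : Hom P P U) : μ.zeroLocus ≤ U := sSup_le fun _ h => h.1

theorem idLocus_le (μ : Hom P P U) : μ.idLocus ≤ U := sSup_le fun _ h => h.1

theorem VanishesOn.le_zeroLocus (h : μ.VanishesOn W) (hW : W ≤ U) : W ≤ μ.zeroLocus :=
  le_sSup ⟨hW, h⟩

theorem IsIdOn.le_idLocus (h : μ.IsIdOn W) (hW : W ≤ U) : W ≤ μ.idLocus := le_sSup ⟨hW, h⟩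

theorem vanishesOn_zeroLocus (hP : P.IsSheaf) (μ : Hom P P U) : μ.VanishesOn μ.zeroLocus := by
  intro V hV hVZ a
  refine hP.eq_of_locally fun x hx => ?_
  obtain ⟨W, ⟨-, hvan⟩, hxW⟩ := Opens.mem_sSup.1 (hVZ hx)
  exact ⟨V ⊓ W, inf_le_left, ⟨hx, hxW⟩, by
    rw [hvan.res_app hV inf_le_left inf_le_right, map_zero]⟩

theorem isIdOn_idLocus (hP : P.IsSheaf) (μ : Hom P P U) : μ.IsIdOn μ.idLocus := by
  intro V hV hVN a
  refine hP.eq_of_locally fun x hx => ?_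
  obtain ⟨W, ⟨-, hid⟩, hxW⟩ := Opens.mem_sSup.1 (hVN hx)
  exact ⟨V ⊓ W, inf_le_left, ⟨hx, hxW⟩, hid.res_app hV inf_le_left inf_le_right a⟩

theorem app_congr_of_le_sup (hP : P.IsSheaf) (hU : U ≤ W ⊔ μ.zeroLocus) (hV : V ≤ U)
    {a b : P.obj V}
    (h : P.res (inf_le_left : V ⊓ W ≤ V) a = P.res (inf_le_left : V ⊓ W ≤ V) b) :
    μ.app V hV a = μ.app V hV b := by
  have hvan := μ.vanishesOn_zeroLocus hP
  refine hP.eq_of_sup (V := V ⊓ W) (Z := V ⊓ μ.zeroLocus) inf_le_left inf_le_left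
    ((le_inf le_rfl (hV.trans hU)).trans (inf_sup_left _ _ _).le) ?_ ?_
  · rw [μ.app_res, μ.app_res, h]
  · rw [hvan.res_app hV inf_le_left inf_le_right, hvan.res_app hV inf_le_left inf_le_right]

theorem app_app_of_le_sup (hP : P.IsSheaf) {ν : Hom P P U} (hU : U ≤ ν.idLocus ⊔ μ.zeroLocus)
    (hV : V ≤ U) (a : P.obj V) : μ.app V hV (ν.app V hV a) = μ.app V hV a :=
  app_congr_of_le_sup hP hU hV ((ν.isIdOn_idLocus hP).res_app hV inf_le_left inf_le_right a)

theorem mem_support_or_mem_zeroLocus (μ : Hom P P U) {x : X} (hx : x ∈ U) :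
    x ∈ μ.support ∨ x ∈ μ.zeroLocus := by
  by_contra! h
  exact h.1 ⟨hx, fun W hW hxW hvan => h.2 (hvan.le_zeroLocus hW hxW)⟩

theorem VanishesOn.disjoint_support (h : μ.VanishesOn W) (hW : W ≤ U) :
    ¬ (μ.support ∩ (W : Set X)).Nonempty :=
  fun ⟨_, hx, hxW⟩ => hx.2 W hW hxW h

theorem le_zeroLocus_of_disjoint_support (hW : W ≤ U) (h : ¬ (μ.support ∩ (W : Set X)).Nonempty) :
    W ≤ μ.zeroLocus :=
  fun _ hx => (μ.mem_support_or_mem_zeroLocus (hW hx)).resolve_left fun hs => h ⟨_, hs, hx⟩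

theorem le_sup_zeroLocus (h : μ.support ⊆ V) : U ≤ V ⊔ μ.zeroLocus :=
  fun _ hx => (μ.mem_support_or_mem_zeroLocus hx).imp_left fun hs => h hs

theorem support_subset_of_le_sup (hV : U ≤ V ⊔ Z) (hZ : Z ≤ U) (h : μ.VanishesOn Z) :
    μ.support ⊆ V :=
  fun _ hx => (hV hx.1).resolve_right fun hxZ => hx.2 Z hZ hxZ h

namespace IsPartitionOfUnity

variable {ι : Type u} {c : ι → Opens X} {η : ι → Hom P P U}

theorem exists_finset (hη : IsPartitionOfUnity c η) {x : X} (hx : x ∈ U) :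
    ∃ W : Opens X, x ∈ W ∧ W ≤ U ∧ ∃ J : Finset ι, ∀ i ∉ J, W ≤ (η i).zeroLocus := by
  obtain ⟨W, hxW, hW, hfin⟩ := hη.locallyFinite x hx
  exact ⟨W, hxW, hW, hfin.toFinset, fun i hi =>
    le_zeroLocus_of_disjoint_support hW fun h => hi (hfin.mem_toFinset.2 h)⟩

theorem sum_eq_of_vanishesOn (hP : P.IsSheaf) (hη : IsPartitionOfUnity c η) (hV : V ≤ U)
    {J : Finset ι} (hJ : ∀ i ∉ J, (η i).VanishesOn V) (a : P.obj V) :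
    ∑ i ∈ J, (η i).app V hV a = a := by
  have hsub : {i | ((η i).support ∩ (V : Set X)).Nonempty} ⊆ J := fun i hi =>
    by_contra fun hiJ => (hJ i hiJ).disjoint_support hV hi
  have hfin := J.finite_toSet.subset hsub
  refine (Finset.sum_subset (fun i hi => hsub (hfin.mem_toFinset.1 hi)) fun i _ hi => ?_).symm.trans
    (hη.sum_eq V hV hfin a)
  exact (η i).vanishesOn_zeroLocus hP V hV
    (le_zeroLocus_of_disjoint_support hV fun h => hi (hfin.mem_toFinset.2 h)) a

theorem of_locally (hP : P.IsSheaf) (hsupp : ∀ i, (η i).support ⊆ c i)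
    (hloc : ∀ x ∈ U, ∃ W : Opens X, x ∈ W ∧ W ≤ U ∧ ∃ J : Finset ι,
      (∀ i ∉ J, (η i).VanishesOn W) ∧
      ∀ (V : Opens X) (hV : V ≤ U), V ≤ W → ∀ a : P.obj V, ∑ i ∈ J, (η i).app V hV a = a) :
    IsPartitionOfUnity c η where
  locallyFinite x hx := by
    obtain ⟨W, hxW, hW, J, hJ, -⟩ := hloc x hx
    exact ⟨W, hxW, hW, J.finite_toSet.subset fun i hi =>
      by_contra fun hiJ => (hJ i hiJ).disjoint_support hW hi⟩
  support_subset := hsupp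
  sum_eq V hV hfin a := by
    refine hP.eq_of_locally fun x hx => ?_
    obtain ⟨W, hxW, -, J, hJ, hsum⟩ := hloc x (hV hx)
    have hVW : V ⊓ W ≤ U := inf_le_left.trans hV
    refine ⟨V ⊓ W, inf_le_left, ⟨hx, hxW⟩, ?_⟩
    have hres : P.res inf_le_left (∑ i ∈ hfin.toFinset, (η i).app V hV a)
        = ∑ i ∈ hfin.toFinset, (η i).app (V ⊓ W) hVW (P.res inf_le_left a) := by
      simp only [map_sum, (η _).app_res]
    rw [hres]
    refine Eq.trans ?_ (hsum (V ⊓ W) hVW inf_le_right (P.res inf_le_left a))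
    have outside_J (i : ι) (hi : i ∉ J) : (η i).app (V ⊓ W) hVW (P.res inf_le_left a) = 0 :=
      hJ i hi _ _ inf_le_right _
    have outside_fin (i : ι) (hi : i ∉ hfin.toFinset) :
        (η i).app (V ⊓ W) hVW (P.res inf_le_left a) = 0 :=
      (η i).vanishesOn_zeroLocus hP _ _ (inf_le_left.trans
        (le_zeroLocus_of_disjoint_support hV fun h => hi (hfin.mem_toFinset.2 h))) _
    classical
    exact (Finset.sum_subset Finset.subset_union_left fun i _ hi => outside_fin i hi).trans
      (Finset.sum_subset Finset.subset_union_right fun i _ hi => outside_J i hi).symm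

end IsPartitionOfUnity

end Hom

theorem IsSheaf.exists_extend_app (hP : P.IsSheaf) (μ : Hom P P U) (hV : V ≤ U)
    (hU : U ≤ V ⊔ μ.zeroLocus) (a : P.obj V) :
    ∃ b : P.obj U, P.res hV b = μ.app V hV a ∧ P.res μ.zeroLocus_le b = 0 :=
  hP.exists_glue_sup hV μ.zeroLocus_le hU _ _ <| by
    rw [(μ.vanishesOn_zeroLocus hP).res_app hV _ inf_le_right, map_zero]

theorem IsSheaf.exists_locallyFinite_sum (hP : P.IsSheaf) {ι : Type*} (t : ι → P.obj U)
    (Z : ι → Opens X) (hZ : ∀ i, Z i ≤ U) (ht : ∀ i, P.res (hZ i) (t i) = 0)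
    (hfin : ∀ x ∈ U, ∃ W : Opens X, x ∈ W ∧ W ≤ U ∧ ∃ J : Finset ι, ∀ i ∉ J, W ≤ Z i) :
    ∃ a : P.obj U, ∀ (W : Opens X) (hW : W ≤ U) (J : Finset ι), (∀ i ∉ J, W ≤ Z i) →
      P.res hW a = P.res hW (∑ i ∈ J, t i) := by
  have sum_eq (W : Opens X) (hW : W ≤ U) (J J' : Finset ι) (hJ : ∀ i ∉ J, W ≤ Z i)
      (hJJ' : J ⊆ J') : ∑ i ∈ J, P.res hW (t i) = ∑ i ∈ J', P.res hW (t i) :=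
    Finset.sum_subset hJJ' fun i _ hi => by
      rw [← P.res_res (hJ i hi) (hZ i), ht, map_zero]
  obtain ⟨a, ha⟩ := hP.exists_glue (U := U)
    (fun W hW s => ∃ J : Finset ι, (∀ i ∉ J, W ≤ Z i) ∧ s = ∑ i ∈ J, P.res hW (t i))
    (fun x hx => by
      obtain ⟨W, hxW, hW, J, hJ⟩ := hfin x hx
      exact ⟨W, hW, _, hxW, J, hJ, rfl⟩) (by
    rintro W W' hW hW' _ _ ⟨J, hJ, rfl⟩ ⟨J', hJ', rfl⟩
    classical
    simp only [map_sum, P.res_res]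
    exact (sum_eq _ _ J (J ∪ J') (fun i hi => inf_le_left.trans (hJ i hi))
      Finset.subset_union_left).trans (sum_eq _ _ J' (J ∪ J')
        (fun i hi => inf_le_right.trans (hJ' i hi)) Finset.subset_union_right).symm)
  exact ⟨a, fun W hW J hJ => (ha W hW _ ⟨J, hJ, rfl⟩).trans (map_sum _ _ _).symm⟩

end VPresheaf

/-! ## Locally convex sheaves -/

namespace LCSheaf

variable {X : Type u} [TopologicalSpace X] (E : LCSheaf.{u, v} X) {U V : Opens X}

instance : PolynormableSpace ℂ (E.obj U) := polynormableSpace_of_locallyConvexSpace_real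

/-- The restriction maps as continuous linear maps. -/
def resCLM (h : V ≤ U) : E.obj U →L[ℂ] E.obj V := ⟨E.res h, E.continuous_res h⟩

@[simp] theorem resCLM_apply (h : V ≤ U) (a : E.obj U) : E.resCLM h a = E.res h a := rfl

variable {E}

/-- The maps of a continuous endomorphism as continuous linear maps. -/
def IsContinuous.appCLM {μ : E.EndOn U} (hμ : IsContinuous μ) (hV : V ≤ U) :
    E.obj V →L[ℂ] E.obj V := ⟨μ.app V hV, hμ V hV⟩

variable (E)

theorem continuous_of_locally {M : Type*} [TopologicalSpace M] {f : M → E.obj U}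
    (h : ∀ x ∈ U, ∃ (W : Opens X) (hW : W ≤ U), x ∈ W ∧ Continuous fun m => E.res hW (f m)) :
    Continuous f := by
  have h' (x : U) := h x x.2
  choose W hW hx hcont using h'
  rw [continuous_iff_le_induced, E.projective U U W hW (le_iSup_of_forall_mem hx), induced_iInf]
  refine le_iInf fun i => ?_
  rw [induced_compose]
  exact continuous_iff_le_induced.1 (hcont i)

theorem tendsto_of_locally {M : Type*} {l : Filter M} {f : M → E.obj U} {a : E.obj U}
    (h : ∀ x ∈ U, ∃ (W : Opens X) (hW : W ≤ U), x ∈ W ∧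
      Tendsto (fun m => E.res hW (f m)) l (𝓝 (E.res hW a))) : Tendsto f l (𝓝 a) := by
  have h' (x : U) := h x x.2
  choose W hW hx hlim using h'
  rw [E.projective U U W hW (le_iSup_of_forall_mem hx), nhds_iInf, tendsto_iInf]
  intro i
  rw [nhds_induced, tendsto_comap_iff]
  exact hlim i

theorem exists_seminorm_le_sum {ι : Type u} {c : ι → Opens X} (hc : ∀ i, c i ≤ U)
    (hU : U ≤ ⨆ i, c i) (p : Seminorm ℂ (E.obj U)) (hp : Continuous p) :
    ∃ (J : Finset (Σ i, {q : Seminorm ℂ (E.obj (c i)) // Continuous q})) (C : ℝ≥0),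
      ∀ a, p a ≤ C * ∑ j ∈ J, j.2.1 (E.res (hc j.1) a) := by
  have hsemi := withSeminorms_iInf (𝕜 := ℂ) (t := fun i => induced (E.res (hc i)) (E.top (c i)))
    fun i => LinearMap.withSeminorms_induced (PolynormableSpace.withSeminorms ℂ (E.obj (c i)))
      (E.res (hc i))
  rw [← E.projective U ι c hc hU] at hsemi
  obtain ⟨J, C, -, hpJ⟩ := Seminorm.bound_of_continuous hsemi p hp
  refine ⟨J, C, fun a => (hpJ a).trans (mul_le_mul_of_nonneg_left ?_ C.2)⟩
  exact Seminorm.finset_sup_apply_le (Finset.sum_nonneg fun j _ => apply_nonneg _ _) fun j hj =>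
    Finset.single_le_sum (f := fun j => j.2.1 (E.res (hc j.1) a)) (fun _ _ => apply_nonneg _ _) hj

theorem isSmoothCurve_of_locally {c : ℝ → E.obj U}
    (h : ∀ x ∈ U, ∃ (W : Opens X) (hW : W ≤ U), x ∈ W ∧ IsSmoothCurve fun t => E.res hW (c t)) :
    IsSmoothCurve c := by
  have exists_deriv (n : ℕ) (t : ℝ) : ∃ a : E.obj U, ∀ (W : Opens X) (hW : W ≤ U) (s : E.obj W),
      ((IsSmoothCurve fun t => E.res hW (c t)) ∧
        s = curveDeriv^[n] (fun t => E.res hW (c t)) t) → E.res hW a = s := by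
    refine E.isSheaf.exists_glue _ (fun x hx => ?_) ?_
    · obtain ⟨W, hW, hxW, hs⟩ := h x hx
      exact ⟨W, hW, _, hxW, hs, rfl⟩
    · rintro W W' hW hW' s s' ⟨hs, rfl⟩ ⟨hs', rfl⟩
      have left := map_iterate_curveDeriv (E.resCLM (inf_le_left : W ⊓ W' ≤ W)) hs n t
      have right := map_iterate_curveDeriv (E.resCLM (inf_le_right : W ⊓ W' ≤ W')) hs' n t
      simp only [resCLM_apply, E.res_res] at left right
      rw [left, right]
  choose d hd using exists_deriv
  refine ⟨d, funext fun t => E.isSheaf.eq_of_locally fun x hx => ?_, fun n t => ?_⟩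
  · obtain ⟨W, hW, hxW, hs⟩ := h x hx
    exact ⟨W, hW, hxW, hd 0 t W hW _ ⟨hs, rfl⟩⟩
  · refine E.tendsto_of_locally fun x hx => ?_
    obtain ⟨W, hW, hxW, hs⟩ := h x hx
    obtain ⟨e, he0, he⟩ := id hs
    have res_d (n : ℕ) (t : ℝ) : E.res hW (d n t) = e n t := by
      rw [hd n t W hW _ ⟨hs, rfl⟩, iterate_curveDeriv_eq he0 he]
    refine ⟨W, hW, hxW, ?_⟩
    simp only [map_smul, map_sub, res_d]
    exact he n t

theorem exists_extend_app {μ : E.EndOn U} (hμ : IsContinuous μ) (hV : V ≤ U)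
    (hU : U ≤ V ⊔ μ.zeroLocus) :
    ∃ e : E.obj V →L[ℂ] E.obj U, (∀ a, E.res hV (e a) = μ.app V hV a) ∧
      ∀ a, E.res μ.zeroLocus_le (e a) = 0 := by
  choose e heV heZ using E.isSheaf.exists_extend_app μ hV hU
  refine ⟨⟨⟨⟨e, fun a b => ?_⟩, fun c a => ?_⟩, ?_⟩, heV, heZ⟩
  · exact E.isSheaf.eq_of_sup hV μ.zeroLocus_le hU (by simp only [map_add, heV])
      (by simp only [map_add, heZ, add_zero])
  · exact E.isSheaf.eq_of_sup hV μ.zeroLocus_le hU (by simp only [map_smul, heV, RingHom.id_apply])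
      (by simp only [map_smul, heZ, smul_zero])
  · refine E.continuous_of_locally fun x hx => ?_
    rcases hU hx with hxV | hxZ
    · exact ⟨V, hV, hxV, by simpa only [heV] using hμ V hV⟩
    · exact ⟨μ.zeroLocus, μ.zeroLocus_le, hxZ, by simpa only [heZ] using continuous_const⟩

end LCSheaf

/-! ## Relatively compact open subsets -/

section RelCompact

variable {X : Type u} [TopologicalSpace X] {U V W : Opens X}

theorem RelCompact.le (h : RelCompact V U) : V ≤ U :=
  fun _ hx => h.2 (subset_closure hx)

theorem RelCompact.mono (h : RelCompact W V) (hV : V ≤ U) : RelCompact W U :=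
  ⟨h.1, h.2.trans hV⟩

/-- The open complement in `U` of the closure of `W`. -/
def awayFrom (U W : Opens X) : Opens X :=
  ⟨(U : Set X) \ closure (W : Set X), U.isOpen.sdiff isClosed_closure⟩

theorem awayFrom_le (U W : Opens X) : awayFrom U W ≤ U := fun _ hx => hx.1

theorem RelCompact.le_sup_awayFrom (h : RelCompact W V) (U : Opens X) :
    U ≤ V ⊔ awayFrom U W := by
  intro x hx
  by_cases hxW : x ∈ closure (W : Set X)
  exacts [Or.inl (h.2 hxW), Or.inr ⟨hx, hxW⟩]

theorem le_of_le_sup_awayFrom (hWU : W ≤ U) (h : U ≤ V ⊔ awayFrom U W) : W ≤ V :=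
  fun _ hx => (h (hWU hx)).resolve_right fun hx' => hx'.2 (subset_closure hx)

variable [LocallyCompactSpace X] [RegularSpace X]

theorem exists_relCompact_of_isCompact {K : Set X} (hK : IsCompact K) (hKU : K ⊆ U) :
    ∃ V : Opens X, K ⊆ V ∧ RelCompact V U := by
  obtain ⟨V, hV, hKV, hVU, hc⟩ := exists_open_between_and_isCompact_closure hK U.isOpen hKU
  exact ⟨⟨V, hV⟩, hKV, hc, hVU⟩

theorem exists_relCompact_of_mem {x : X} (hx : x ∈ U) :
    ∃ V : Opens X, x ∈ V ∧ RelCompact V U := by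
  obtain ⟨V, hV, hVU⟩ := exists_relCompact_of_isCompact isCompact_singleton
    (singleton_subset_iff.2 hx)
  exact ⟨V, hV rfl, hVU⟩

theorem RelCompact.exists_between (h : RelCompact W U) :
    ∃ V : Opens X, RelCompact W V ∧ RelCompact V U := by
  obtain ⟨V, hWV, hVU⟩ := exists_relCompact_of_isCompact h.1 h.2
  exact ⟨V, ⟨h.1, hWV⟩, hVU⟩

theorem exists_relCompact_pair_of_le_sup {V₁ V₀ Z : Opens X} (hU : U ≤ V ⊔ Z)
    (hV₁ : RelCompact V₁ V₀) (hV₀ : V₀ ≤ U) :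
    ∃ W₁ W₀ : Opens X, RelCompact W₁ W₀ ∧ RelCompact W₀ V ∧ W₀ ≤ V₀ ∧ V₁ ≤ W₁ ⊔ Z := by
  have hK : IsCompact (closure (V₁ : Set X) \ Z) := hV₁.1.diff Z.isOpen
  have hKV : closure (V₁ : Set X) \ Z ⊆ (V ⊓ V₀ : Opens X) := fun x hx =>
    ⟨(hU (hV₀ (hV₁.2 hx.1))).resolve_right hx.2, hV₁.2 hx.1⟩
  obtain ⟨W₁, hKW, hW₁⟩ := exists_relCompact_of_isCompact hK hKV
  obtain ⟨W₀, hW₁₀, hW₀⟩ := hW₁.exists_between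
  refine ⟨W₁, W₀, hW₁₀, hW₀.mono inf_le_left, hW₀.le.trans inf_le_right, fun x hx => ?_⟩
  by_cases hxZ : x ∈ Z
  exacts [Or.inr hxZ, Or.inl (hKW ⟨subset_closure hx, hxZ⟩)]

end RelCompact

/-! ## Cut-off morphisms of a test pair -/

namespace TestPair

variable {X : Type u} [TopologicalSpace X] (P : TestPair.{u, v, w} X) {U V : Opens X}

/-- A continuous endomorphism `η` of `E|_U` together with its restriction `θ` to `F|_U`. -/
structure EndPair (U : Opens X) where
  η : P.E.EndOn U
  θ : P.F.EndOn U
  contE : LCSheaf.IsContinuous η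
  contF : LCSheaf.IsContinuous θ
  compat : ∀ (V : Opens X) (hV : V ≤ U) (φ : P.F.obj V),
    η.app V hV (P.incl V φ) = P.incl V (θ.app V hV φ)

variable {P}

namespace EndPair

variable (κ : P.EndPair U)

theorem θ_vanishesOn_zeroLocus : κ.θ.VanishesOn κ.η.zeroLocus := fun V hV hVZ φ =>
  P.incl_injective V <| by
    rw [← κ.compat, κ.η.vanishesOn_zeroLocus P.E.isSheaf V hV hVZ, map_zero]

theorem θ_isIdOn_idLocus : κ.θ.IsIdOn κ.η.idLocus := fun V hV hVN φ =>
  P.incl_injective V <| by rw [← κ.compat, κ.η.isIdOn_idLocus P.E.isSheaf V hV hVN]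

theorem zeroLocus_η_le_zeroLocus_θ : κ.η.zeroLocus ≤ κ.θ.zeroLocus :=
  κ.θ_vanishesOn_zeroLocus.le_zeroLocus κ.η.zeroLocus_le

end EndPair

theorem exists_endPair_partition {ι : Type u} {c : ι → Opens X} (hc : ∀ i, c i ≤ U)
    (hU : U ≤ ⨆ i, c i) :
    ∃ κ : ι → P.EndPair U, VPresheaf.Hom.IsPartitionOfUnity c fun i => (κ i).η := by
  obtain ⟨η, hη, hcont, hF⟩ := P.exists_partition U ι c hc hU
  choose θ hθ hcompat using hF
  exact ⟨fun i => ⟨η i, θ i, hcont i, hθ i, hcompat i⟩, hη⟩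

theorem EndPair.sum_θ_app {ι : Type u} {c : ι → Opens X} {κ : ι → P.EndPair U}
    (hκ : VPresheaf.Hom.IsPartitionOfUnity c fun i => (κ i).η) (hV : V ≤ U) {J : Finset ι}
    (hJ : ∀ i ∉ J, V ≤ (κ i).η.zeroLocus) (φ : P.F.obj V) :
    ∑ i ∈ J, (κ i).θ.app V hV φ = φ := P.incl_injective V <| by
  simp only [map_sum, ← (κ _).compat]
  exact hκ.sum_eq_of_vanishesOn P.E.isSheaf hV
    (fun i hi => ((κ i).η.vanishesOn_zeroLocus P.E.isSheaf).mono (hJ i hi)) _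

theorem exists_cutoff {Z : Opens X} (hV : V ≤ U) (hZ : Z ≤ U) (hU : U ≤ V ⊔ Z) :
    ∃ κ : P.EndPair U, U ≤ κ.η.idLocus ⊔ Z ∧ U ≤ V ⊔ κ.η.zeroLocus := by
  let c : ULift.{u} Bool → Opens X := fun b => cond b.down V Z
  obtain ⟨κ, hκ⟩ := P.exists_endPair_partition (c := c) (fun ⟨b⟩ => by cases b <;> assumption)
    fun x hx => Opens.mem_iSup.2 <| (hU hx).elim (fun h => ⟨⟨true⟩, h⟩) fun h => ⟨⟨false⟩, h⟩
  have hid : (κ ⟨true⟩).η.IsIdOn (κ ⟨false⟩).η.zeroLocus := fun W hW hWZ a => by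
    have hsum := hκ.sum_eq_of_vanishesOn P.E.isSheaf hW (J := {⟨true⟩}) (fun i hi => by
      obtain ⟨_ | _⟩ := i
      · exact ((κ ⟨false⟩).η.vanishesOn_zeroLocus P.E.isSheaf).mono hWZ
      · exact absurd (Finset.mem_singleton_self _) hi) a
    rwa [Finset.sum_singleton] at hsum
  refine ⟨κ ⟨true⟩, ?_, VPresheaf.Hom.le_sup_zeroLocus (hκ.support_subset ⟨true⟩)⟩
  calc U ≤ Z ⊔ (κ ⟨false⟩).η.zeroLocus :=
        VPresheaf.Hom.le_sup_zeroLocus (hκ.support_subset ⟨false⟩)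
    _ = (κ ⟨false⟩).η.zeroLocus ⊔ Z := sup_comm _ _
    _ ≤ (κ ⟨true⟩).η.idLocus ⊔ Z :=
        sup_le_sup_right (hid.le_idLocus (VPresheaf.Hom.zeroLocus_le _)) Z

/-- Compatible operators `E(V) → E(U)` and `F(V) → F(U)` that apply the cut-off `κ` to a section
over `V` and extend the result by zero to `U`. -/
structure Extension (κ : P.EndPair U) (hV : V ≤ U) where
  E : P.E.obj V →L[ℂ] P.E.obj U
  F : P.F.obj V →L[ℂ] P.F.obj U
  le_sup : U ≤ V ⊔ κ.η.zeroLocus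
  res_E : ∀ u, P.E.res hV (E u) = κ.η.app V hV u
  res_F : ∀ φ, P.F.res hV (F φ) = κ.θ.app V hV φ
  res_E_zero : ∀ u, P.E.res κ.η.zeroLocus_le (E u) = 0
  res_F_zero : ∀ φ, P.F.res κ.η.zeroLocus_le (F φ) = 0

theorem EndPair.exists_extension (κ : P.EndPair U) (hV : V ≤ U) (hU : U ≤ V ⊔ κ.η.zeroLocus) :
    Nonempty (Extension κ hV) := by
  have hle := κ.zeroLocus_η_le_zeroLocus_θ
  obtain ⟨e, he, he0⟩ := P.E.exists_extend_app κ.contE hV hU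
  obtain ⟨f, hf, hf0⟩ := P.F.exists_extend_app κ.contF hV (hU.trans (sup_le_sup_left hle V))
  refine ⟨⟨e, f, hU, he, hf, he0, fun φ => ?_⟩⟩
  rw [← P.F.res_res hle κ.θ.zeroLocus_le, hf0, map_zero]

namespace Extension

variable {κ : P.EndPair U} {hV : V ≤ U} (e : Extension κ hV)

theorem E_incl (φ : P.F.obj V) : e.E (P.incl V φ) = P.incl U (e.F φ) := by
  refine P.E.isSheaf.eq_of_sup hV κ.η.zeroLocus_le e.le_sup ?_ ?_
  · rw [e.res_E, ← P.incl_res, e.res_F, κ.compat]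
  · rw [e.res_E_zero, ← P.incl_res, e.res_F_zero, map_zero]

theorem E_res (u : P.E.obj U) : e.E (P.E.res hV u) = κ.η.app U le_rfl u := by
  refine P.E.isSheaf.eq_of_sup hV κ.η.zeroLocus_le e.le_sup ?_ ?_
  · rw [e.res_E, κ.η.app_res]
  · rw [e.res_E_zero, (κ.η.vanishesOn_zeroLocus P.E.isSheaf).res_app _ _ le_rfl]

theorem res_E_eq_zero {O : Opens X} (hO : O ≤ V) {u : P.E.obj V} (h : P.E.res hO u = 0) :
    P.E.res (hO.trans hV) (e.E u) = 0 := by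
  rw [← P.E.res_res hO hV, e.res_E, κ.η.app_res, h, map_zero]

theorem res_F_eq_zero {O O' : Opens X} (hO : O ≤ U) (hO' : O' ≤ V)
    (hOO' : O ≤ O' ⊔ κ.η.zeroLocus) {φ : P.F.obj V} (h : P.F.res hO' φ = 0) :
    P.F.res hO (e.F φ) = 0 := by
  refine P.F.isSheaf.eq_of_sup (V := O ⊓ O') (Z := O ⊓ κ.η.zeroLocus) inf_le_left inf_le_left
    ((le_inf le_rfl hOO').trans (inf_sup_left _ _ _).le) ?_ ?_
  · rw [P.F.res_res, map_zero, ← P.F.res_res (inf_le_right.trans hO' : O ⊓ O' ≤ V) hV, e.res_F,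
      κ.θ.app_res, ← P.F.res_res inf_le_right hO', h, map_zero, map_zero]
  · rw [P.F.res_res, map_zero, ← P.F.res_res (inf_le_right : O ⊓ κ.η.zeroLocus ≤ _)
      κ.η.zeroLocus_le, e.res_F_zero, map_zero]

end Extension

end TestPair

/-! ## Growth along scales -/

instance toZero_neBot : toZero.NeBot := by
  refine comap_neBot_iff.2 fun t ht => ?_
  obtain ⟨ε, hε, hεt⟩ := Filter.nonempty_of_mem
    (inter_mem (Ioc_mem_nhdsGT (zero_lt_one : (0 : ℝ) < 1)) ht)
  exact ⟨⟨ε, hε⟩, hεt⟩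

theorem BigO.of_le {f g : Param → ℝ} {m : Param → ℝ≥0} (hf : ∀ ε, 0 ≤ f ε) (h : ∀ ε, f ε ≤ g ε)
    (hg : BigO g m) : BigO f m :=
  TestPair.BigO_of_le_add (g := 0) hf (by simpa using h) hg (isBigO_zero _ _)

theorem ScalePair.exists_bigO_add (S : ScalePair) {l m : Param → ℝ≥0} (hl : l ∈ S.A)
    (hm : m ∈ S.A) : ∃ n ∈ S.A, BigO (fun ε => (l ε : ℝ)) n ∧ BigO (fun ε => (m ε : ℝ)) n := by
  obtain ⟨n, hn, h⟩ := S.A_add l hl m hm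
  exact ⟨n, hn, h.of_le (fun ε => (l ε).2) fun ε => le_add_of_nonneg_right (m ε).2,
    h.of_le (fun ε => (m ε).2) fun ε => le_add_of_nonneg_left (l ε).2⟩

/-! ## Transport of test objects -/

namespace TestPair

variable {X : Type u} [TopologicalSpace X] {P : TestPair.{u, v, w} X} {S : ScalePair}
  {U V W : Opens X}

/-- Nets of regularization operators that approximate `t_E` and `t_F` the way test objects
approximate the identity. -/
structure IsApprox (S : ScalePair) {U : Opens X} (Φ : P.Net U) (tE : P.E.obj U →L[ℂ] P.E.obj U)
    (tF : P.F.obj U →L[ℂ] P.F.obj U) : Prop where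
  moderate : ∀ p : Seminorm ℂ (P.E.obj U →Lₚₜ[ℂ] P.F.obj U), Continuous p →
    ∃ l ∈ S.A, BigO (fun ε => p ((Φ ε).toPointwiseConvergenceCLM ℂ (RingHom.id ℂ) _ _)) l
  approx : ∀ p : Seminorm ℂ (P.F.obj U →Lₚₜ[ℂ] P.F.obj U), Continuous p → ∀ l ∈ S.I,
    BigO (fun ε => p (((Φ ε).comp (P.incl U) - tF).toPointwiseConvergenceCLM ℂ
      (RingHom.id ℂ) _ _)) l
  tendsto : ∀ u, Tendsto (fun ε => P.incl U (Φ ε u)) toZero (𝓝 (tE u))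

theorem isTestObject_iff {Φ : P.Net U} : P.IsTestObject S Φ ↔
    IsApprox S Φ (ContinuousLinearMap.id ℂ _) (ContinuousLinearMap.id ℂ _) :=
  ⟨fun h => ⟨h.1, h.2, PointwiseConvergenceCLM.tendsto_iff_forall_tendsto.1 h.3⟩,
    fun h => ⟨h.1, h.2, PointwiseConvergenceCLM.tendsto_iff_forall_tendsto.2 h.3⟩⟩

theorem isZeroTestObject_iff {Ψ : P.Net U} : P.IsZeroTestObject S Ψ ↔ IsApprox S Ψ 0 0 :=
  ⟨fun h => ⟨h.1, fun p hp l hl => by simpa only [sub_zero] using h.2 p hp l hl,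
      PointwiseConvergenceCLM.tendsto_iff_forall_tendsto.1 h.3⟩,
    fun h => ⟨h.1, fun p hp l hl => by simpa only [sub_zero] using h.2 p hp l hl,
      PointwiseConvergenceCLM.tendsto_iff_forall_tendsto.2 h.3⟩⟩

namespace IsApprox

theorem zero : IsApprox S (0 : P.Net U) 0 0 where
  moderate p _ := by
    obtain ⟨l, hl, -⟩ := S.A_liminf
    refine ⟨l, hl, ?_⟩
    simp only [Pi.zero_apply, map_zero]
    exact isBigO_zero _ _
  approx p _ l _ := by
    simp only [Pi.zero_apply, ContinuousLinearMap.zero_comp, sub_zero, map_zero]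
    exact isBigO_zero _ _
  tendsto u := by simp

theorem add {Φ Φ' : P.Net U} {tE tE' : P.E.obj U →L[ℂ] P.E.obj U}
    {tF tF' : P.F.obj U →L[ℂ] P.F.obj U} (h : IsApprox S Φ tE tF) (h' : IsApprox S Φ' tE' tF') :
    IsApprox S (fun ε => Φ ε + Φ' ε) (tE + tE') (tF + tF') where
  moderate p hp := by
    obtain ⟨l, hl, hb⟩ := h.moderate p hp
    obtain ⟨l', hl', hb'⟩ := h'.moderate p hp
    obtain ⟨n, hn, hln, hln'⟩ := S.exists_bigO_add hl hl'
    refine ⟨n, hn, BigO_of_le_add (fun _ => apply_nonneg _ _) (fun ε => ?_) (IsBigO.trans hb hln)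
      (IsBigO.trans hb' hln')⟩
    rw [map_add]
    exact map_add_le_add p _ _
  approx p hp l hl := by
    refine BigO_of_le_add (fun _ => apply_nonneg _ _) (fun ε => ?_) (h.approx p hp l hl)
      (h'.approx p hp l hl)
    rw [ContinuousLinearMap.add_comp, add_sub_add_comm, map_add]
    exact map_add_le_add p _ _
  tendsto u := by
    refine ((h.tendsto u).add (h'.tendsto u)).congr fun ε => ?_
    rw [add_apply, map_add]

theorem comp {Φ : P.Net U} {tE : P.E.obj U →L[ℂ] P.E.obj U}
    {tF : P.F.obj U →L[ℂ] P.F.obj U} (h : IsApprox S Φ tE tF)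
    (aE : P.E.obj V →L[ℂ] P.E.obj U) (aF : P.F.obj V →L[ℂ] P.F.obj U)
    (ha : ∀ φ, aE (P.incl V φ) = P.incl U (aF φ))
    (bE : P.E.obj U →L[ℂ] P.E.obj V) (bF : P.F.obj U →L[ℂ] P.F.obj V)
    (hb : ∀ φ, bE (P.incl U φ) = P.incl V (bF φ)) :
    IsApprox S (fun ε => bF.comp ((Φ ε).comp aE)) (bE.comp (tE.comp aE))
      (bF.comp (tF.comp aF)) where
  moderate p hp :=
    h.moderate (p.comp ((PointwiseConvergenceCLM.postcomp _ bF).comp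
      (PointwiseConvergenceCLM.precomp _ aE)).toLinearMap) (hp.comp (ContinuousLinearMap.cont _))
  approx p hp l hl := by
    have hcomp := h.approx (p.comp ((PointwiseConvergenceCLM.postcomp _ bF).comp
      (PointwiseConvergenceCLM.precomp _ aF)).toLinearMap) (hp.comp (ContinuousLinearMap.cont _))
      l hl
    refine IsBigO.congr_left hcomp fun ε => congrArg p ?_
    ext φ
    change bF (Φ ε (P.incl U (aF φ)) - tF (aF φ)) = bF (Φ ε (aE (P.incl V φ))) - bF (tF (aF φ))
    rw [ha, map_sub]
  tendsto u :=
    ((bE.continuous.tendsto _).comp (h.tendsto (aE u))).congr fun _ => hb _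

end IsApprox

theorem eventually_res_eq_of_mem_ROloc {V₀ : Opens X} {Φ : P.Net U} (h : Φ ∈ P.ROloc U)
    (hV : RelCompact V V₀) (hV₀ : RelCompact V₀ U) (hVU : V ≤ U) :
    ∀ᶠ ε in toZero, ∀ u u' : P.E.obj U, P.E.res hV₀.le u = P.E.res hV₀.le u' →
      P.F.res hVU (Φ ε u) = P.F.res hVU (Φ ε u') := by
  filter_upwards [h V V₀ hV hV₀ hV₀.le hVU] with ε hε u u' hu
  rw [← sub_eq_zero, ← map_sub, ← map_sub]
  exact hε (u - u') (by rw [map_sub, hu, sub_self])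

theorem add_mem_ROloc {Φ Φ' : P.Net U} (h : Φ ∈ P.ROloc U) (h' : Φ' ∈ P.ROloc U) :
    (fun ε => Φ ε + Φ' ε) ∈ P.ROloc U := by
  intro V V₀ hV hV₀ h₀ h₁
  filter_upwards [h V V₀ hV hV₀ h₀ h₁, h' V V₀ hV hV₀ h₀ h₁] with ε hε hε' u hu
  rw [add_apply, map_add, hε u hu, hε' u hu, add_zero]

theorem zero_mem_TOzloc : (0 : P.Net U) ∈ P.TOzloc S U :=
  ⟨isZeroTestObject_iff.2 IsApprox.zero, fun _ _ _ _ _ _ =>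
    Eventually.of_forall fun _ _ _ => map_zero (P.F.res _)⟩

theorem add_mem_TOzloc {Ψ Ψ' : P.Net U} (h : Ψ ∈ P.TOzloc S U) (h' : Ψ' ∈ P.TOzloc S U) :
    (fun ε => Ψ ε + Ψ' ε) ∈ P.TOzloc S U := by
  have hadd := (isZeroTestObject_iff.1 h.1).add (isZeroTestObject_iff.1 h'.1)
  rw [add_zero, add_zero] at hadd
  exact ⟨isZeroTestObject_iff.2 hadd, add_mem_ROloc h.2 h'.2⟩

theorem sum_mem_TOzloc {ι : Type*} (J : Finset ι) {Ψ : ι → P.Net U}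
    (h : ∀ i, Ψ i ∈ P.TOzloc S U) : (fun ε => ∑ i ∈ J, Ψ i ε) ∈ P.TOzloc S U := by
  classical
  induction J using Finset.induction_on with
  | empty => exact zero_mem_TOzloc
  | insert i J hi ih =>
    simp only [Finset.sum_insert hi]
    exact add_mem_TOzloc (h i) ih

variable (P) in
/-- Data that transport test objects on `U` to test objects on `V` by
`Φ ↦ bF ∘ Φ ∘ aE + kF ∘ Φ₀`, where `Φ₀` is any test object on `V`. The second summand makes up for
the part `kE = id - bE ∘ aE` that is lost in the passage through `U`. -/
structure Transfer (U V : Opens X) where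
  aE : P.E.obj V →L[ℂ] P.E.obj U
  aF : P.F.obj V →L[ℂ] P.F.obj U
  bE : P.E.obj U →L[ℂ] P.E.obj V
  bF : P.F.obj U →L[ℂ] P.F.obj V
  kE : P.E.obj V →L[ℂ] P.E.obj V
  kF : P.F.obj V →L[ℂ] P.F.obj V
  aE_incl : ∀ φ, aE (P.incl V φ) = P.incl U (aF φ)
  bE_incl : ∀ φ, bE (P.incl U φ) = P.incl V (bF φ)
  kE_incl : ∀ φ, kE (P.incl V φ) = P.incl V (kF φ)
  bE_aE_add_kE : ∀ u, bE (aE u) + kE u = u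
  exists_relCompact : ∀ (V₁ V₀ : Opens X), RelCompact V₁ V₀ → RelCompact V₀ V →
    ∀ (h₁ : V₁ ≤ V) (h₀ : V₀ ≤ V),
    ∃ (U₁ U₀ : Opens X) (hU₁ : U₁ ≤ U) (hU₀ : U₀ ≤ U), RelCompact U₁ U₀ ∧ RelCompact U₀ U ∧
      (∀ u, P.E.res h₀ u = 0 → P.E.res hU₀ (aE u) = 0) ∧
      ∀ φ, P.F.res hU₁ φ = 0 → P.F.res h₁ (bF φ) = 0
  res_kF_eq_zero : ∀ (O : Opens X) (hO : O ≤ V) (φ : P.F.obj V), P.F.res hO φ = 0 →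
    P.F.res hO (kF φ) = 0

namespace Transfer

variable (T : P.Transfer U V)

/-- The transport `Φ ↦ bF ∘ Φ ∘ aE` of regularization operators, which preserves `0`-test
objects. -/
def map : P.RO U →L[ℂ] P.RO V :=
  (ContinuousLinearMap.postcomp _ T.bF).comp (ContinuousLinearMap.precomp _ T.aE)

/-- The transport `Φ ↦ bF ∘ Φ ∘ aE + kF ∘ Φ₀` of regularization operators, which preserves test
objects. -/
def mapAdd (Φ : P.RO U) (Φ₀ : P.RO V) : P.RO V := T.map Φ + T.kF.comp Φ₀

theorem mapAdd_add_smul_map (Φ Ψ : P.RO U) (Φ₀ : P.RO V) (t : ℂ) :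
    T.mapAdd Φ Φ₀ + t • T.map Ψ = T.mapAdd (Φ + t • Ψ) Φ₀ := by
  rw [mapAdd, mapAdd, map_add, map_smul, add_right_comm]

theorem bF_aF_add_kF (φ : P.F.obj V) : T.bF (T.aF φ) + T.kF φ = φ :=
  P.incl_injective V <| by
    rw [map_add, ← T.bE_incl, ← T.aE_incl, ← T.kE_incl, T.bE_aE_add_kE]

theorem map_mem_ROloc {Φ : P.Net U} (h : Φ ∈ P.ROloc U) : (fun ε => T.map (Φ ε)) ∈ P.ROloc V := by
  intro V₁ V₀ hV₁ hV₀ h₀ h₁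
  obtain ⟨U₁, U₀, hU₁, hU₀, hc₁, hc₀, ha, hb⟩ := T.exists_relCompact V₁ V₀ hV₁ hV₀ h₁ h₀
  filter_upwards [h U₁ U₀ hc₁ hc₀ hU₀ hU₁] with ε hε u hu
  exact hb _ (hε _ (ha u hu))

theorem kF_comp_mem_ROloc {Φ : P.Net V} (h : Φ ∈ P.ROloc V) :
    (fun ε => T.kF.comp (Φ ε)) ∈ P.ROloc V := by
  intro V₁ V₀ hV₁ hV₀ h₀ h₁
  filter_upwards [h V₁ V₀ hV₁ hV₀ h₀ h₁] with ε hε u hu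
  exact T.res_kF_eq_zero _ _ _ (hε u hu)

theorem map_mem_TOzloc {Ψ : P.Net U} (h : Ψ ∈ P.TOzloc S U) :
    (fun ε => T.map (Ψ ε)) ∈ P.TOzloc S V := by
  have hcomp := (isZeroTestObject_iff.1 h.1).comp T.aE T.aF T.aE_incl T.bE T.bF T.bE_incl
  simp only [ContinuousLinearMap.zero_comp, ContinuousLinearMap.comp_zero] at hcomp
  exact ⟨isZeroTestObject_iff.2 hcomp, T.map_mem_ROloc h.2⟩

theorem mapAdd_mem_TOloc {Φ : P.Net U} {Φ₀ : P.Net V} (h : Φ ∈ P.TOloc S U)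
    (h₀ : Φ₀ ∈ P.TOloc S V) : (fun ε => T.mapAdd (Φ ε) (Φ₀ ε)) ∈ P.TOloc S V := by
  refine ⟨isTestObject_iff.2 ?_, add_mem_ROloc (T.map_mem_ROloc h.2) (T.kF_comp_mem_ROloc h₀.2)⟩
  have hsum := ((isTestObject_iff.1 h.1).comp T.aE T.aF T.aE_incl T.bE T.bF T.bE_incl).add
    ((isTestObject_iff.1 h₀.1).comp (.id ℂ _) (.id ℂ _) (fun _ => rfl) T.kE T.kF T.kE_incl)
  simp only [ContinuousLinearMap.id_comp, ContinuousLinearMap.comp_id] at hsum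
  rwa [show T.bE.comp T.aE + T.kE = .id ℂ _ from ContinuousLinearMap.ext T.bE_aE_add_kE,
    show T.bF.comp T.aF + T.kF = .id ℂ _ from ContinuousLinearMap.ext T.bF_aF_add_kF] at hsum

end Transfer

variable {χ κ : P.EndPair U} {hV : V ≤ U}

/-- Restriction of test objects from `U` to `V`: sections over `V` are extended to `U` with the
cut-off `χ`, and the results are cut off by `κ`. -/
def restrictTransfer (κ : P.EndPair U) (e : Extension χ hV)
    (hU : U ≤ χ.η.idLocus ⊔ κ.η.zeroLocus) : P.Transfer U V where
  aE := e.E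
  aF := e.F
  bE := κ.contE.appCLM hV ∘L P.E.resCLM hV
  bF := κ.contF.appCLM hV ∘L P.F.resCLM hV
  kE := .id ℂ _ - κ.contE.appCLM hV
  kF := .id ℂ _ - κ.contF.appCLM hV
  aE_incl := e.E_incl
  bE_incl φ := (congrArg _ (P.incl_res hV φ).symm).trans (κ.compat V hV _)
  kE_incl φ := (congrArg _ (κ.compat V hV φ)).trans (map_sub (P.incl V) _ _).symm
  bE_aE_add_kE u := by
    change κ.η.app V hV (P.E.res hV (e.E u)) + (u - κ.η.app V hV u) = u
    rw [e.res_E, VPresheaf.Hom.app_app_of_le_sup P.E.isSheaf hU, add_sub_cancel]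
  exists_relCompact V₁ V₀ hV₁ hV₀ h₁ h₀ := by
    refine ⟨V₁, V₀, h₁.trans hV, h₀.trans hV, hV₁, hV₀.mono hV, fun u hu => e.res_E_eq_zero h₀ hu,
      fun φ hφ => ?_⟩
    change P.F.res h₁ (κ.θ.app V hV (P.F.res hV φ)) = 0
    rw [κ.θ.app_res, P.F.res_res, hφ, map_zero]
  res_kF_eq_zero O hO φ hφ := by
    change P.F.res hO (φ - κ.θ.app V hV φ) = 0
    rw [map_sub, κ.θ.app_res, hφ, map_zero, sub_zero]

/-- Extension of test objects from `V` to `U`: sections over `U` are restricted to `V`, and the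
results are extended to `U` with the cut-off `κ`. -/
def extendTransfer [LocallyCompactSpace X] [RegularSpace X] (e : Extension κ hV) :
    P.Transfer V U where
  aE := P.E.resCLM hV
  aF := P.F.resCLM hV
  bE := e.E
  bF := e.F
  kE := .id ℂ _ - κ.contE.appCLM le_rfl
  kF := .id ℂ _ - κ.contF.appCLM le_rfl
  aE_incl φ := (P.incl_res hV φ).symm
  bE_incl := e.E_incl
  kE_incl φ := (congrArg _ (κ.compat U le_rfl φ)).trans (map_sub (P.incl U) _ _).symm
  bE_aE_add_kE u := by
    change e.E (P.E.res hV u) + (u - κ.η.app U le_rfl u) = u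
    rw [e.E_res, add_sub_cancel]
  exists_relCompact U₁ U₀ hU₁ _ h₁ h₀ := by
    obtain ⟨V₁, V₀, hV₁, hV₀, hle, hsup⟩ := exists_relCompact_pair_of_le_sup e.le_sup hU₁ h₀
    refine ⟨V₁, V₀, hV₁.le.trans hV₀.le, hV₀.le, hV₁, hV₀, fun u hu => ?_,
      fun φ hφ => e.res_F_eq_zero h₁ _ hsup hφ⟩
    change P.E.res hV₀.le (P.E.res hV u) = 0
    rw [P.E.res_res, ← P.E.res_res hle h₀, hu, map_zero]
  res_kF_eq_zero O hO φ hφ := by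
    change P.F.res hO (φ - κ.θ.app U le_rfl φ) = 0
    rw [map_sub, κ.θ.app_res, hφ, map_zero, sub_zero]

theorem res_restrictTransfer_mapAdd (e : Extension χ hV)
    (hU : U ≤ χ.η.idLocus ⊔ κ.η.zeroLocus) {O : Opens X} (hO : O ≤ κ.η.idLocus) (hOV : O ≤ V)
    (Φ : P.RO U) (Φ₀ : P.RO V) (u : P.E.obj V) :
    P.F.res hOV ((restrictTransfer κ e hU).mapAdd Φ Φ₀ u)
      = P.F.res (hOV.trans hV) (Φ (e.E u)) := by
  have hid := κ.θ_isIdOn_idLocus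
  change P.F.res hOV (κ.θ.app V hV (P.F.res hV (Φ (e.E u))) + (Φ₀ u - κ.θ.app V hV (Φ₀ u))) = _
  rw [map_add, map_sub, hid.res_app hV hOV hO, hid.res_app hV hOV hO, sub_self, add_zero,
    P.F.res_res]

theorem res_extendTransfer_mapAdd [LocallyCompactSpace X] [RegularSpace X] (e : Extension κ hV)
    {O : Opens X} (hO : O ≤ κ.η.idLocus) (hOV : O ≤ V) (Φ : P.RO V) (Φ₀ : P.RO U)
    (u : P.E.obj U) :
    P.F.res (hOV.trans hV) ((extendTransfer e).mapAdd Φ Φ₀ u)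
      = P.F.res hOV (Φ (P.E.res hV u)) := by
  have hid := κ.θ_isIdOn_idLocus
  change P.F.res _ (e.F (Φ (P.E.res hV u)) + (Φ₀ u - κ.θ.app U le_rfl (Φ₀ u))) = _
  rw [map_add, map_sub, hid.res_app _ _ hO, sub_self, add_zero, ← P.F.res_res hOV hV, e.res_F,
    hid.res_app hV hOV hO]

theorem exists_restrictTransfer {A : Opens X} (e : Extension χ hV) (hA : A ≤ U)
    (hU : U ≤ χ.η.idLocus ⊔ A) :
    ∃ (T : P.Transfer U V) (N : Opens X), U ≤ N ⊔ A ∧ ∀ O ≤ N, ∀ (hO : O ≤ V) (Φ : P.RO U)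
      (Φ₀ : P.RO V) (u : P.E.obj V),
      P.F.res hO (T.mapAdd Φ Φ₀ u) = P.F.res (hO.trans hV) (Φ (e.E u)) := by
  obtain ⟨κ, hid, hzero⟩ := exists_cutoff (P := P) χ.η.idLocus_le hA hU
  exact ⟨restrictTransfer κ e hzero, κ.η.idLocus, hid,
    fun O hO hOV => res_restrictTransfer_mapAdd e hzero hO hOV⟩

theorem exists_extendTransfer [LocallyCompactSpace X] [RegularSpace X] (hV : V ≤ U)
    (hW : RelCompact W V) :
    ∃ T : P.Transfer V U, ∀ (Φ : P.RO V) (Φ₀ : P.RO U) (u : P.E.obj U),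
      P.F.res (hW.le.trans hV) (T.mapAdd Φ Φ₀ u) = P.F.res hW.le (Φ (P.E.res hV u)) := by
  obtain ⟨κ, hid, hzero⟩ := exists_cutoff (P := P) hV (awayFrom_le U W) (hW.le_sup_awayFrom U)
  obtain ⟨e⟩ := κ.exists_extension hV hzero
  exact ⟨extendTransfer e, res_extendTransfer_mapAdd e
    (le_of_le_sup_awayFrom (hW.le.trans hV) hid) hW.le⟩

/-! ## Restriction of local maps -/

section Restriction

variable {h : V ≤ U} {R R₁ R₂ : P.RO U → P.F.obj U} {R' R₁' R₂' : P.RO V → P.F.obj V}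

theorem IsBasicLocal.isRestriction_self (hR : IsBasicLocal R) : IsRestriction le_rfl R R := by
  intro W _ hW Φ Φ' hΦ
  refine hR.isLocal W hW Φ Φ' fun u => ?_
  rw [← hΦ, P.E.res_self]

theorem IsRestriction.add (h₁ : IsRestriction h R₁ R₁') (h₂ : IsRestriction h R₂ R₂') :
    IsRestriction h (R₁ + R₂) (R₁' + R₂') := fun W hWc hW Φ Φ' hΦ => by
  rw [Pi.add_apply, Pi.add_apply, map_add, map_add, h₁ W hWc hW Φ Φ' hΦ, h₂ W hWc hW Φ Φ' hΦ]

theorem IsRestriction.smul (a : ℂ) (hR : IsRestriction h R R') :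
    IsRestriction h (a • R) (a • R') := fun W hWc hW Φ Φ' hΦ => by
  rw [Pi.smul_apply, Pi.smul_apply, map_smul, map_smul, hR W hWc hW Φ Φ' hΦ]

variable [LocallyCompactSpace X] [RegularSpace X]

theorem exists_extendCLM (hV : V ≤ U) (hW : RelCompact W V) :
    ∃ L : P.RO V →L[ℂ] P.RO U, ∀ (Φ : P.RO V) (u : P.E.obj U),
      P.F.res hW.le (Φ (P.E.res hV u)) = P.F.res (hW.le.trans hV) (L Φ u) := by
  obtain ⟨T, hT⟩ := exists_extendTransfer (P := P) hV hW
  refine ⟨T.map, fun Φ u => ?_⟩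
  rw [← hT Φ 0 u, Transfer.mapAdd, ContinuousLinearMap.comp_zero, add_zero]

theorem IsLocal.exists_isRestriction (hR : IsLocal R) (h : V ≤ U) :
    ∃ R' : P.RO V → P.F.obj V, IsRestriction h R R' := by
  have exists_value : ∀ Φ : P.RO V, ∃ a : P.F.obj V, ∀ (W : Opens X) (hW : W ≤ V) (s : P.F.obj W),
      (RelCompact W V ∧ ∃ Φ' : P.RO U,
        (∀ u, P.F.res hW (Φ (P.E.res h u)) = P.F.res (hW.trans h) (Φ' u)) ∧
        s = P.F.res (hW.trans h) (R Φ')) → P.F.res hW a = s := by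
    intro Φ
    refine P.F.isSheaf.exists_glue _ (fun x hx => ?_) ?_
    · obtain ⟨W, hxW, hW⟩ := exists_relCompact_of_mem hx
      obtain ⟨L, hL⟩ := exists_extendCLM (P := P) h hW
      exact ⟨W, hW.le, _, hxW, hW, L Φ, hL Φ, rfl⟩
    · rintro W W' hW hW' _ _ ⟨-, Φ₁, h₁, rfl⟩ ⟨-, Φ₂, h₂, rfl⟩
      rw [P.F.res_res, P.F.res_res]
      refine hR _ _ _ _ fun u => ?_
      rw [← P.F.res_res inf_le_left (hW.trans h), ← h₁, P.F.res_res,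
        ← P.F.res_res inf_le_right (hW'.trans h), ← h₂, P.F.res_res]
  choose R' hR' using exists_value
  exact ⟨R', fun W hWc hW Φ Φ' hΦ => hR' Φ W hW _ ⟨hWc, Φ', hΦ, rfl⟩⟩

namespace IsRestriction

theorem eq (h₁ : IsRestriction h R R₁') (h₂ : IsRestriction h R R₂') : R₁' = R₂' := by
  funext Φ
  refine P.F.isSheaf.eq_of_locally fun x hx => ?_
  obtain ⟨W, hxW, hW⟩ := exists_relCompact_of_mem hx
  obtain ⟨L, hL⟩ := exists_extendCLM (P := P) h hW
  exact ⟨W, hW.le, hxW, by rw [h₁ W hW _ Φ _ (hL Φ), h₂ W hW _ Φ _ (hL Φ)]⟩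

theorem trans {hW : W ≤ V} {R'' : P.RO W → P.F.obj W} (hR : IsRestriction h R R')
    (hR' : IsRestriction hW R' R'') : IsRestriction (hW.trans h) R R'' := by
  intro O hO hOW Φ Φ' hΦ
  obtain ⟨L, hL⟩ := exists_extendCLM (P := P) hW hO
  rw [hR' O hO hOW Φ (L Φ) (hL Φ)]
  refine hR O (hO.mono hW) _ _ _ fun u => ?_
  rw [← hL, P.E.res_res]
  exact hΦ u

theorem isSmoothMap (hR' : IsRestriction h R R') (hR : IsSmoothMap R) : IsSmoothMap R' := by
  refine fun c hc => P.F.isSmoothCurve_of_locally fun x hx => ?_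
  obtain ⟨W, hxW, hW⟩ := exists_relCompact_of_mem hx
  obtain ⟨L, hL⟩ := exists_extendCLM (P := P) h hW
  refine ⟨W, hW.le, hxW, ?_⟩
  simp_rw [fun t => hR' W hW hW.le (c t) (L (c t)) (hL _)]
  exact (hR _ (hc.map L)).map (P.F.resCLM (hW.le.trans h))

theorem isLocal (hR' : IsRestriction h R R') : IsLocal R' := by
  refine fun O hO Φ₁ Φ₂ hΦ => P.F.isSheaf.eq_of_locally fun x hx => ?_
  obtain ⟨W, hxW, hW⟩ := exists_relCompact_of_mem hx
  have hWV := hW.mono hO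
  obtain ⟨L, hL⟩ := exists_extendCLM (P := P) h hWV
  refine ⟨W, hW.le, hxW, ?_⟩
  rw [P.F.res_res, P.F.res_res, hR' W hWV _ Φ₁ (L Φ₁) (hL _),
    hR' W hWV _ Φ₂ (L Φ₁) fun u => ?_]
  rw [← hL]
  exact P.F.res_congr hO hW.le (hΦ _).symm

end IsRestriction

theorem IsBasicLocal.exists_restriction (hR : IsBasicLocal R) (h : V ≤ U) :
    ∃ R' : P.RO V → P.F.obj V, IsBasicLocal R' ∧ IsRestriction h R R' := by
  obtain ⟨R', hR'⟩ := hR.isLocal.exists_isRestriction h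
  exact ⟨R', ⟨hR'.isSmoothMap hR.smooth, hR'.isLocal⟩, hR'⟩

end Restriction

end TestPair

/-! ## Growth of directional derivatives -/

/-- Classes of nets of reals that are stable under sums and under domination. They treat the
moderate and the negligible nets simultaneously. -/
structure IsSolidClass (B : Set (Param → ℝ)) : Prop where
  zero_mem : 0 ∈ B
  add_mem : ∀ {f g : Param → ℝ}, f ∈ B → g ∈ B → f + g ∈ B
  of_isBigO : ∀ {f g : Param → ℝ}, g ∈ B → f =O[toZero] g → f ∈ B

namespace IsSolidClass

variable {B : Set (Param → ℝ)}

theorem sum_mem (hB : IsSolidClass B) {ι : Type*} (J : Finset ι) {f : ι → Param → ℝ}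
    (hf : ∀ i ∈ J, f i ∈ B) : ∑ i ∈ J, f i ∈ B :=
  Finset.sum_induction _ (· ∈ B) (fun _ _ => hB.add_mem) hB.zero_mem hf

theorem of_le (hB : IsSolidClass B) {f g : Param → ℝ} (hg : g ∈ B) (hf : ∀ ε, 0 ≤ f ε)
    (h : ∀ᶠ ε in toZero, f ε ≤ g ε) : f ∈ B :=
  hB.of_isBigO hg <| IsBigO.of_bound 1 <| h.mono fun ε hε => by
    rw [one_mul, Real.norm_of_nonneg (hf ε)]
    exact hε.trans (le_abs_self _)

theorem const_mul_mem (hB : IsSolidClass B) {f : Param → ℝ} (hf : f ∈ B) (a : ℝ) :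
    (fun ε => a * f ε) ∈ B :=
  hB.of_isBigO hf (isBigO_const_mul_self a f _)

end IsSolidClass

namespace TestPair

variable {X : Type u} [TopologicalSpace X] {P : TestPair.{u, v, w} X} {S : ScalePair}
  {U V W : Opens X}

/-- The nets of moderate growth. -/
def moderateClass (S : ScalePair) : Set (Param → ℝ) := {f | ∃ m ∈ S.A, BigO f m}

/-- The negligible nets. -/
def negligibleClass (S : ScalePair) : Set (Param → ℝ) := {f | ∀ m ∈ S.I, BigO f m}

theorem isSolidClass_moderateClass (S : ScalePair) : IsSolidClass (moderateClass S) where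
  zero_mem := by
    obtain ⟨l, hl, -⟩ := S.A_liminf
    exact ⟨l, hl, isBigO_zero _ _⟩
  add_mem := by
    rintro f g ⟨l, hl, hf⟩ ⟨m, hm, hg⟩
    obtain ⟨n, hn, hln, hmn⟩ := S.exists_bigO_add hl hm
    exact ⟨n, hn, (IsBigO.trans hf hln).add (IsBigO.trans hg hmn)⟩
  of_isBigO := by
    rintro f g ⟨l, hl, hg⟩ hfg
    exact ⟨l, hl, hfg.trans hg⟩

theorem isSolidClass_negligibleClass (S : ScalePair) : IsSolidClass (negligibleClass S) where
  zero_mem _ _ := isBigO_zero _ _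
  add_mem hf hg m hm := (hf m hm).add (hg m hm)
  of_isBigO hg hfg m hm := hfg.trans (hg m hm)

/-- The directional derivatives of `R` along test objects have bounds in the class `B`. By
polarization this is moderateness or negligibility, according to the choice of `B`. -/
def DirBound (S : ScalePair) (B : Set (Param → ℝ)) (R : P.RO U → P.F.obj U) : Prop :=
  ∀ p : Seminorm ℂ (P.F.obj U), Continuous p → ∀ l : ℕ, ∀ Φ ∈ P.TOloc S U, ∀ Ψ ∈ P.TOzloc S U,
    (fun ε => p (dirDeriv l R (Φ ε) (Ψ ε))) ∈ B

variable {B : Set (Param → ℝ)} {R : P.RO U → P.F.obj U} {R' : P.RO V → P.F.obj V}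

theorem forall_differential_iff_dirBound (hB : IsSolidClass B) (hR : IsSmoothMap R) :
    (∀ p : Seminorm ℂ (P.F.obj U), Continuous p → ∀ (l : ℕ), ∀ Φ ∈ P.TOloc S U,
      ∀ Ψ : Fin l → P.Net U, (∀ j, Ψ j ∈ P.TOzloc S U) →
        (fun ε => p (differential l R (Φ ε) fun j => Ψ j ε)) ∈ B) ↔ DirBound S B R := by
  refine ⟨fun h p hp l Φ hΦ Ψ hΨ => ?_, fun h p hp l Φ hΦ Ψ hΨ => ?_⟩
  · simpa only [differential_diag hR] using h p hp l Φ hΦ (fun _ => Ψ) fun _ => hΨ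
  have hsum (J : Finset (Fin l)) := h p hp l Φ hΦ _ (sum_mem_TOzloc J hΨ)
  refine hB.of_le (hB.const_mul_mem (hB.sum_mem Finset.univ fun J _ => hsum J)
    ‖((l.factorial : ℂ)⁻¹)‖) (fun _ => apply_nonneg _ _) (Eventually.of_forall fun ε => ?_)
  rw [differential_eq_sum_dirDeriv, map_smul_eq_mul, Finset.sum_apply]
  refine mul_le_mul_of_nonneg_left ?_ (norm_nonneg _)
  refine (Finset.le_sum_of_subadditive p (map_zero p).le (map_add_le_add p) _ _).trans
    (Finset.sum_le_sum fun J _ => ?_)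
  simp [map_smul_eq_mul]

theorem isModerate_iff_dirBound (hR : IsSmoothMap R) :
    IsModerate S R ↔ DirBound S (moderateClass S) R :=
  forall_differential_iff_dirBound (isSolidClass_moderateClass S) hR

theorem isNegligible_iff_dirBound (hR : IsSmoothMap R) :
    IsNegligible S R ↔ DirBound S (negligibleClass S) R :=
  forall_differential_iff_dirBound (isSolidClass_negligibleClass S) hR

theorem DirBound.clm_comp (h : DirBound S B R) (hR : IsSmoothMap R)
    (T : P.F.obj U →L[ℂ] P.F.obj U) : DirBound S B fun Φ => T (R Φ) := by
  intro p hp l Φ hΦ Ψ hΨ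
  have hcomm (ε) : T (dirDeriv l R (Φ ε) (Ψ ε)) = dirDeriv l (fun Φ => T (R Φ)) (Φ ε) (Ψ ε) :=
    dirDeriv_congr hR (hR.clm_comp T) T (.id ℂ _) (fun _ => rfl) l
  simp only [← hcomm]
  exact h (p.comp T.toLinearMap) (hp.comp T.continuous) l Φ hΦ Ψ hΨ

/-- On `W`, the values of `R` along test objects on `U` are eventually the images under a fixed
continuous linear map of the values of `R'` along suitable test objects on `V`. -/
def FactorsOn (S : ScalePair) (hW : W ≤ U) (R : P.RO U → P.F.obj U)
    (R' : P.RO V → P.F.obj V) : Prop :=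
  ∃ τ : P.F.obj V →L[ℂ] P.F.obj W, ∀ Φ ∈ P.TOloc S U, ∀ Ψ ∈ P.TOzloc S U,
    ∃ Φ' ∈ P.TOloc S V, ∃ Ψ' ∈ P.TOzloc S V, ∀ᶠ ε in toZero, ∀ t : ℂ,
      P.F.res hW (R (Φ ε + t • Ψ ε)) = τ (R' (Φ' ε + t • Ψ' ε))

theorem FactorsOn.of_res_eq {hW : W ≤ U} {R' : P.RO U → P.F.obj U}
    (h : ∀ Φ, P.F.res hW (R Φ) = P.F.res hW (R' Φ)) : FactorsOn S hW R R' :=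
  ⟨P.F.resCLM hW, fun Φ hΦ Ψ hΨ => ⟨Φ, hΦ, Ψ, hΨ, Eventually.of_forall fun _ _ => h _⟩⟩

theorem FactorsOn.of_transfer {hW : W ≤ U} (T : P.Transfer U V)
    (τ : P.F.obj V →L[ℂ] P.F.obj W) (hV : (P.TOloc S V).Nonempty)
    (h : ∀ Φ ∈ P.TOloc S U, ∀ Ψ ∈ P.TOzloc S U, ∀ᶠ ε in toZero, ∀ (t : ℂ) (Φ₀ : P.RO V),
      P.F.res hW (R (Φ ε + t • Ψ ε)) = τ (R' (T.mapAdd (Φ ε + t • Ψ ε) Φ₀))) :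
    FactorsOn S hW R R' := by
  obtain ⟨Φ₀, hΦ₀⟩ := hV
  refine ⟨τ, fun Φ hΦ Ψ hΨ => ⟨_, T.mapAdd_mem_TOloc hΦ hΦ₀, _, T.map_mem_TOzloc hΨ, ?_⟩⟩
  filter_upwards [h Φ hΦ Ψ hΨ] with ε hε t
  rw [T.mapAdd_add_smul_map, hε t (Φ₀ ε)]

theorem DirBound.of_locally (hB : IsSolidClass B) (hR : IsSmoothMap R)
    (h : ∀ x ∈ U, ∃ (W : Opens X) (hW : W ≤ U) (V : Opens X) (R' : P.RO V → P.F.obj V),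
      x ∈ W ∧ IsSmoothMap R' ∧ DirBound S B R' ∧ FactorsOn S hW R R') : DirBound S B R := by
  have h' (x : U) := h x x.2
  choose W hW V R' hxW hR' hbd τ hτ using h'
  intro p hp l Φ hΦ Ψ hΨ
  obtain ⟨J, C, hpJ⟩ := P.F.exists_seminorm_le_sum hW
    (fun x hx => Opens.mem_iSup.2 ⟨⟨x, hx⟩, hxW _⟩) p hp
  choose Φ' hΦ' Ψ' hΨ' he using fun x => hτ x Φ hΦ Ψ hΨ
  refine hB.of_le (hB.const_mul_mem (hB.sum_mem J fun j _ =>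
    hbd j.1 (j.2.1.comp (τ j.1).toLinearMap) (j.2.2.comp (τ j.1).continuous) l (Φ' j.1) (hΦ' j.1)
      (Ψ' j.1) (hΨ' j.1)) C) (fun _ => apply_nonneg _ _) ?_
  filter_upwards [(Filter.eventually_all_finset J).2 fun j _ => he j.1] with ε hε
  rw [Finset.sum_apply]
  refine (hpJ _).trans (mul_le_mul_of_nonneg_left (Finset.sum_le_sum fun j hj =>
    le_of_eq (congrArg j.2.1 ?_)) C.2)
  exact dirDeriv_congr hR (hR' j.1) (P.F.resCLM (hW j.1)) (τ j.1) (fun t => hε j hj t) l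

theorem DirBound.zero (hB : IsSolidClass B) :
    DirBound S B (fun _ => 0 : P.RO U → P.F.obj U) := by
  intro p _ l Φ _ Ψ _
  have hsmooth : IsSmoothMap (fun _ => 0 : P.RO U → P.F.obj U) := IsBasicLocal.zero.smooth
  have hzero (ε) : dirDeriv l (fun _ => 0 : P.RO U → P.F.obj U) (Φ ε) (Ψ ε) = 0 :=
    dirDeriv_congr hsmooth hsmooth (.id ℂ _) (0 : P.F.obj U →L[ℂ] P.F.obj U)
      (x := Φ ε) (v := Ψ ε) (x' := Φ ε) (v' := Ψ ε) (fun _ => rfl) l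
  simp only [hzero, map_zero]
  exact hB.zero_mem

theorem DirBound.of_locally_eq_zero (hB : IsSolidClass B) (hR : IsSmoothMap R)
    (h : ∀ x ∈ U, ∃ (W : Opens X) (hW : W ≤ U), x ∈ W ∧
      ∀ Φ ∈ P.TOloc S U, ∀ Ψ ∈ P.TOzloc S U, ∀ᶠ ε in toZero, ∀ t : ℂ,
        P.F.res hW (R (Φ ε + t • Ψ ε)) = 0) : DirBound S B R := by
  refine DirBound.of_locally hB hR fun x hx => ?_
  obtain ⟨W, hW, hxW, hzero⟩ := h x hx
  exact ⟨W, hW, U, _, hxW, IsBasicLocal.zero.smooth, .zero hB, P.F.resCLM hW, fun Φ hΦ Ψ hΨ =>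
    ⟨Φ, hΦ, Ψ, hΨ, (hzero Φ hΦ Ψ hΨ).mono fun ε hε t => (hε t).trans (map_zero _).symm⟩⟩

section Restriction

variable [LocallyCompactSpace X] [RegularSpace X] {hV : V ≤ U}

theorem DirBound.restriction (hB : IsSolidClass B) (hU : (P.TOloc S U).Nonempty)
    (hres : IsRestriction hV R R') (hR : IsSmoothMap R) (hbd : DirBound S B R) :
    DirBound S B R' := by
  refine DirBound.of_locally hB (hres.isSmoothMap hR) fun x hx => ?_
  obtain ⟨W, hxW, hW⟩ := exists_relCompact_of_mem hx
  obtain ⟨T, hT⟩ := exists_extendTransfer (P := P) hV hW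
  exact ⟨W, hW.le, U, R, hxW, hR, hbd, .of_transfer T (P.F.resCLM (hW.le.trans hV)) hU
    fun Φ _ Ψ _ => Eventually.of_forall fun ε t Φ₀ => hres W hW _ _ _ fun u => (hT _ _ u).symm⟩

theorem IsRestriction.factorsOn (hres : IsRestriction hV R R') (hTO : (P.TOloc S V).Nonempty)
    (hW : RelCompact W V) : FactorsOn S (hW.le.trans hV) R R' := by
  obtain ⟨W₀, hWW₀, hW₀⟩ := hW.exists_between
  obtain ⟨χ, hid, hzero⟩ := exists_cutoff (P := P) hV (awayFrom_le U W₀) (hW₀.le_sup_awayFrom U)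
  obtain ⟨e⟩ := χ.exists_extension hV hzero
  have hW₀χ : W₀ ≤ χ.η.idLocus := le_of_le_sup_awayFrom (hW₀.le.trans hV) hid
  obtain ⟨T, N, hN, hT⟩ := exists_restrictTransfer e (awayFrom_le U W)
    ((hWW₀.mono hW₀χ).le_sup_awayFrom U)
  have hWN : W ≤ N := le_of_le_sup_awayFrom (hW.le.trans hV) hN
  refine .of_transfer T (P.F.resCLM hW.le) hTO fun Φ hΦ Ψ hΨ => ?_
  filter_upwards [eventually_res_eq_of_mem_ROloc hΦ.2 hWW₀ (hW₀.mono hV) (hW.le.trans hV),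
    eventually_res_eq_of_mem_ROloc hΨ.2 hWW₀ (hW₀.mono hV) (hW.le.trans hV)] with ε hΦε hΨε t Φ₀
  refine (hres W hW hW.le _ _ fun u => ?_).symm
  rw [hT W hWN, e.E_res]
  have hu : P.E.res (hW₀.mono hV).le (χ.η.app U le_rfl u) = P.E.res (hW₀.mono hV).le u :=
    (χ.η.isIdOn_idLocus P.E.isSheaf).res_app _ _ hW₀χ u
  rw [add_apply, add_apply, smul_apply, smul_apply, map_add, map_add, map_smul, map_smul,
    hΦε _ _ hu, hΨε _ _ hu]

theorem DirBound.of_restrictions (hB : IsSolidClass B)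
    (hTO : ∀ V : Opens X, (P.TOloc S V).Nonempty) (hR : IsSmoothMap R)
    (h : ∀ x ∈ U, ∃ (V : Opens X) (hV : V ≤ U) (R' : P.RO V → P.F.obj V), x ∈ V ∧
      IsRestriction hV R R' ∧ DirBound S B R') : DirBound S B R := by
  refine DirBound.of_locally hB hR fun x hx => ?_
  obtain ⟨V, hV, R', hxV, hres, hbd⟩ := h x hx
  obtain ⟨W, hxW, hW⟩ := exists_relCompact_of_mem hxV
  exact ⟨W, hW.le.trans hV, V, R', hxW, hres.isSmoothMap hR, hbd, hres.factorsOn (hTO V) hW⟩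

end Restriction

end TestPair

/-! ## The presheaf `𝒢_loc` -/

namespace TestPair

variable {X : Type u} [TopologicalSpace X] {P : TestPair.{u, v, w} X} {S : ScalePair}
  {U V W : Opens X}

theorem mem_Mloc_iff_dirBound {R : P.RO U → P.F.obj U} :
    R ∈ P.Mloc S U ↔ IsBasicLocal R ∧ DirBound S (moderateClass S) R :=
  and_congr_right fun hR => isModerate_iff_dirBound hR.smooth

theorem mem_Nloc_iff_dirBound {R : P.RO U → P.F.obj U} :
    R ∈ P.Nloc S U ↔ IsBasicLocal R ∧ DirBound S (negligibleClass S) R :=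
  and_congr_right fun hR => isNegligible_iff_dirBound hR.smooth

theorem dirBound_of_mem_Mloc (R : P.Mloc S U) : DirBound S (moderateClass S) R.1 :=
  (mem_Mloc_iff_dirBound.1 R.2).2

theorem cls_eq_cls_iff {R R' : P.Mloc S U} :
    cls R = cls R' ↔ DirBound S (negligibleClass S) (R - R').1 :=
  (Submodule.Quotient.eq _).trans <|
    mem_Nloc_iff_dirBound.trans <| and_iff_right (R - R').2.1

theorem exists_cls_eq (g : P.Gloc S U) : ∃ R : P.Mloc S U, cls R = g :=
  Submodule.mkQ_surjective _ g

section Presheaf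

variable [LocallyCompactSpace X] [RegularSpace X]

theorem exists_restriction_Mloc (hU : (P.TOloc S U).Nonempty) (hV : V ≤ U) (R : P.Mloc S U) :
    ∃ R' : P.Mloc S V, IsRestriction hV R.1 R'.1 := by
  obtain ⟨R', hR', hres⟩ := R.2.1.exists_restriction hV
  exact ⟨⟨R', mem_Mloc_iff_dirBound.2 ⟨hR', .restriction (isSolidClass_moderateClass S) hU hres
    R.2.1.smooth (dirBound_of_mem_Mloc R)⟩⟩, hres⟩

/-- The restriction `R ↦ ρ^ℰ_{V,U}(R)` of moderate local maps. -/
def resM (hU : (P.TOloc S U).Nonempty) (hV : V ≤ U) : P.Mloc S U →ₗ[ℂ] P.Mloc S V where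
  toFun R := (exists_restriction_Mloc hU hV R).choose
  map_add' R₁ R₂ := Subtype.ext <|
    (exists_restriction_Mloc hU hV (R₁ + R₂)).choose_spec.eq <|
      (exists_restriction_Mloc hU hV R₁).choose_spec.add
        (exists_restriction_Mloc hU hV R₂).choose_spec
  map_smul' a R := Subtype.ext <|
    (exists_restriction_Mloc hU hV (a • R)).choose_spec.eq <|
      (exists_restriction_Mloc hU hV R).choose_spec.smul a

theorem isRestriction_resM (hU : (P.TOloc S U).Nonempty) (hV : V ≤ U) (R : P.Mloc S U) :
    IsRestriction hV R.1 (resM hU hV R).1 :=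
  (exists_restriction_Mloc hU hV R).choose_spec

theorem resM_mem_Nloc (hU : (P.TOloc S U).Nonempty) (hV : V ≤ U) {R : P.Mloc S U}
    (hR : R.1 ∈ P.Nloc S U) : (resM hU hV R).1 ∈ P.Nloc S V :=
  mem_Nloc_iff_dirBound.2 ⟨(resM hU hV R).2.1, .restriction (isSolidClass_negligibleClass S) hU
    (isRestriction_resM hU hV R) R.2.1.smooth (mem_Nloc_iff_dirBound.1 hR).2⟩

/-- The restriction maps `[R] ↦ [ρ^ℰ_{V,U}(R)]` of `𝒢_loc`. -/
def resG (hU : (P.TOloc S U).Nonempty) (hV : V ≤ U) : P.Gloc S U →ₗ[ℂ] P.Gloc S V :=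
  Submodule.mapQ _ _ (resM hU hV) fun _ hR => resM_mem_Nloc hU hV hR

theorem resG_cls (hU : (P.TOloc S U).Nonempty) {hV : V ≤ U} {R : P.Mloc S U}
    {R' : P.Mloc S V} (hR : IsRestriction hV R.1 R'.1) : resG hU hV (cls R) = cls R' :=
  congrArg cls (Subtype.ext ((isRestriction_resM hU hV R).eq hR))

/-- The presheaf `𝒢_loc` with the restriction maps `[R] ↦ [ρ^ℰ_{V,U}(R)]`. -/
def glocPresheaf (hTO : ∀ U : Opens X, (P.TOloc S U).Nonempty) : P.GlocPresheaf S where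
  res := resG (hTO _)
  res_self U g := by
    obtain ⟨R, rfl⟩ := exists_cls_eq g
    exact resG_cls (hTO U) R.2.1.isRestriction_self
  res_res {U V W} hWV hVU g := by
    obtain ⟨R, rfl⟩ := exists_cls_eq g
    have hV := isRestriction_resM (hTO U) hVU R
    have hW := isRestriction_resM (hTO V) hWV (resM (hTO U) hVU R)
    rw [resG_cls (hTO U) hV, resG_cls (hTO V) hW, resG_cls (hTO U) (hV.trans hW)]
  res_mk {U V} h R :=
    ⟨resM (hTO U) h R, isRestriction_resM (hTO U) h R, rfl⟩

namespace GlocPresheaf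

variable (G : P.GlocPresheaf S)

theorem res_cls {hV : V ≤ U} {R : P.Mloc S U} {R' : P.Mloc S V}
    (hR : IsRestriction hV R.1 R'.1) : G.res hV (cls R) = cls R' := by
  obtain ⟨R'', hR'', he⟩ := G.res_mk hV R
  rw [he, Subtype.ext (hR''.eq hR)]

theorem eq (G G' : P.GlocPresheaf S) : G = G' := by
  have hres : @G.res = @G'.res := by
    funext U V hV
    refine LinearMap.ext fun g => ?_
    obtain ⟨R, rfl⟩ := exists_cls_eq g
    obtain ⟨R', hR', he⟩ := G.res_mk hV R
    rw [he, G'.res_cls hR']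
  cases G
  cases G'
  simpa only [mk.injEq] using hres

theorem res_cls_congr (hV : V ≤ U) {R R' : P.Mloc S U}
    (h : ∀ Φ, P.F.res hV (R.1 Φ) = P.F.res hV (R'.1 Φ)) :
    G.res hV (cls R) = G.res hV (cls R') := by
  obtain ⟨R'', hR'', he⟩ := G.res_mk hV R
  rw [he, G.res_cls (R' := R'')]
  intro W hWV hW Φ Φ' hΦ
  rw [hR'' W hWV hW Φ Φ' hΦ]
  exact P.F.res_congr hV hW (h Φ')

theorem eq_of_locally (hTO : ∀ U : Opens X, (P.TOloc S U).Nonempty) {a b : P.Gloc S U}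
    (h : ∀ x ∈ U, ∃ (W : Opens X) (hW : W ≤ U), x ∈ W ∧ G.res hW a = G.res hW b) : a = b := by
  obtain ⟨R, rfl⟩ := exists_cls_eq a
  obtain ⟨R', rfl⟩ := exists_cls_eq b
  refine cls_eq_cls_iff.2 <| DirBound.of_restrictions (isSolidClass_negligibleClass S) hTO
    (R - R').2.1.smooth fun x hx => ?_
  obtain ⟨W, hW, hxW, he⟩ := h x hx
  have hres := isRestriction_resM (hTO U) hW
  rw [G.res_cls (hres R), G.res_cls (hres R'), cls_eq_cls_iff, ← map_sub] at he
  exact ⟨W, hW, _, hxW, hres (R - R'), he⟩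

end GlocPresheaf

end Presheaf

/-! ## Endomorphisms of `𝒢_loc` -/

section Endomorphisms

variable {T : P.F.EndOn U}

theorem IsBasicLocal.app_comp (hT : LCSheaf.IsContinuous T) {hV : V ≤ U}
    {R : P.RO V → P.F.obj V} (hR : IsBasicLocal R) :
    IsBasicLocal fun Φ => T.app V hV (R Φ) :=
  ⟨hR.smooth.clm_comp (hT.appCLM hV), fun W hW Φ₁ Φ₂ hΦ => by
    rw [T.app_res, T.app_res, hR.isLocal W hW Φ₁ Φ₂ hΦ]⟩

variable (hT : LCSheaf.IsContinuous T)

/-- Composition `R ↦ T_V ∘ R` of moderate local maps with an endomorphism `T` of `F|_U`. -/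
def endM (hV : V ≤ U) : P.Mloc S V →ₗ[ℂ] P.Mloc S V where
  toFun R := ⟨fun Φ => T.app V hV (R.1 Φ), mem_Mloc_iff_dirBound.2
    ⟨R.2.1.app_comp hT, (dirBound_of_mem_Mloc R).clm_comp R.2.1.smooth (hT.appCLM hV)⟩⟩
  map_add' R R' := Subtype.ext <| funext fun Φ => map_add (T.app V hV) (R.1 Φ) (R'.1 Φ)
  map_smul' a R := Subtype.ext <| funext fun Φ => map_smul (T.app V hV) a (R.1 Φ)

theorem endM_mem_Nloc (hV : V ≤ U) {R : P.Mloc S V} (hR : R.1 ∈ P.Nloc S V) :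
    (endM hT hV R).1 ∈ P.Nloc S V :=
  mem_Nloc_iff_dirBound.2 ⟨(endM hT hV R).2.1,
    (mem_Nloc_iff_dirBound.1 hR).2.clm_comp R.2.1.smooth (hT.appCLM hV)⟩

theorem IsRestriction.endM {hV : V ≤ U} {hW : W ≤ V} {R : P.Mloc S V} {R' : P.Mloc S W}
    (h : IsRestriction hW R.1 R'.1) :
    IsRestriction hW (endM hT hV R).1 (endM hT (hW.trans hV) R').1 := by
  intro O hOc hO Φ Φ' hΦ
  change P.F.res _ (T.app _ _ _) = P.F.res _ (T.app _ _ _)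
  rw [T.app_res, T.app_res, h O hOc hO Φ Φ' hΦ]

namespace GlocPresheaf

variable [LocallyCompactSpace X] [RegularSpace X] (G : P.GlocPresheaf S)

/-- The endomorphism `[R] ↦ [T_V ∘ R]` of `𝒢_loc|_U` induced by an endomorphism `T` of `F|_U`. -/
def endHom : VPresheaf.Hom G.toVPresheaf G.toVPresheaf U where
  app V hV := Submodule.mapQ _ _ (endM hT hV) fun _ hR => endM_mem_Nloc hT hV hR
  app_res {V W} hV hW g := by
    obtain ⟨R, rfl⟩ := exists_cls_eq g
    obtain ⟨R', hR', he⟩ := G.res_mk hW R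
    change _ = Submodule.mapQ _ _ _ _ (G.res hW (cls R))
    rw [he]
    exact G.res_cls (hR'.endM hT)

theorem endHom_app_res (hV : V ≤ U) (hW : W ≤ V) (g : P.Gloc S V) :
    (G.endHom hT).app W (hW.trans hV) (G.res hW g) = G.res hW ((G.endHom hT).app V hV g) :=
  ((G.endHom hT).app_res hV hW g).symm

theorem endHom_isIdOn (h : T.IsIdOn W) : (G.endHom hT).IsIdOn W := by
  intro V hV hVW g
  obtain ⟨R, rfl⟩ := exists_cls_eq g
  exact congrArg cls (Subtype.ext (funext fun Φ => h V hV hVW _))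

theorem endHom_vanishesOn (h : T.VanishesOn W) : (G.endHom hT).VanishesOn W := by
  intro V hV hVW g
  obtain ⟨R, rfl⟩ := exists_cls_eq g
  exact congrArg cls (Subtype.ext (funext fun Φ => h V hV hVW _) : endM hT hV R = 0)

theorem sum_endHom_app {ι : Type*} {μ : ι → P.F.EndOn U}
    (hμ : ∀ i, LCSheaf.IsContinuous (μ i)) (hV : V ≤ U) (J : Finset ι)
    (h : ∀ φ, ∑ i ∈ J, (μ i).app V hV φ = φ) (g : P.Gloc S V) :
    ∑ i ∈ J, (G.endHom (hμ i)).app V hV g = g := by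
  obtain ⟨R, rfl⟩ := exists_cls_eq g
  have hsum : ∑ i ∈ J, endM (hμ i) hV R = R := Subtype.ext <| funext fun Φ => by
    rw [Submodule.coe_sum, Finset.sum_apply]
    exact h _
  exact (map_sum (Submodule.mkQ _) (fun i => endM (hμ i) hV R) J).symm.trans (congrArg cls hsum)

end GlocPresheaf

end Endomorphisms

/-! ## Extension by cut-off and gluing -/

section Extension

variable {hV : V ≤ U} {κ χ : P.EndPair U} (f : Extension κ hV) (e : Extension χ hV)
  {R : P.RO V → P.F.obj V} {B : Set (Param → ℝ)}

/-- The operator `ℒ(E(U), F(U)) → ℒ(E(V), F(V))` that extends sections of `E(V)` to `U` with the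
help of a cut-off. -/
def Extension.pullback : P.RO U →L[ℂ] P.RO V :=
  (ContinuousLinearMap.postcomp _ (P.F.resCLM hV)).comp (ContinuousLinearMap.precomp _ e.E)

theorem Extension.res_pullback (hW : W ≤ V) (Φ : P.RO U) (u : P.E.obj V) :
    P.F.res hW (e.pullback Φ u) = P.F.res (hW.trans hV) (Φ (e.E u)) :=
  P.F.res_res hW hV _

/-- The map on `U` obtained from a map `R` on `V` by cutting off its arguments with `χ` and its
values with `κ`. -/
def extendMap (R : P.RO V → P.F.obj V) (Φ : P.RO U) : P.F.obj U := f.F (R (e.pullback Φ))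

theorem IsBasicLocal.extendMap (hR : IsBasicLocal R) : IsBasicLocal (extendMap f e R) := by
  refine ⟨(hR.smooth.comp_clm e.pullback).clm_comp f.F, fun O hO Φ₁ Φ₂ hΦ => ?_⟩
  have hOU : O ≤ O ⊓ V ⊔ κ.η.zeroLocus :=
    (le_inf le_rfl (hO.trans f.le_sup)).trans
      (inf_sup_left _ _ _ |>.le.trans (sup_le_sup_left inf_le_right _))
  rw [← sub_eq_zero, ← map_sub, TestPair.extendMap, TestPair.extendMap, ← map_sub]
  refine f.res_F_eq_zero hO inf_le_right hOU ?_
  rw [map_sub, sub_eq_zero]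
  refine hR.isLocal _ inf_le_right _ _ fun u => ?_
  rw [e.res_pullback, e.res_pullback]
  exact P.F.res_congr hO inf_le_left (hΦ _)

theorem DirBound.extendMap (hB : IsSolidClass B) (hV' : (P.TOloc S V).Nonempty)
    (hU : U ≤ χ.η.idLocus ⊔ κ.η.zeroLocus) (hR : IsBasicLocal R) (hbd : DirBound S B R) :
    DirBound S B (extendMap f e R) := by
  refine DirBound.of_locally hB (hR.extendMap f e).smooth fun x hx => ?_
  rcases f.le_sup hx with hxV | hx0
  · obtain ⟨T, N, hN, hT⟩ := exists_restrictTransfer e κ.η.zeroLocus_le hU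
    have hNθ := hN.trans (sup_le_sup_left κ.zeroLocus_η_le_zeroLocus_θ N)
    refine ⟨V, hV, V, R, hxV, hR.smooth, hbd, .of_transfer T (κ.contF.appCLM hV) hV'
      fun Φ _ Ψ _ => Eventually.of_forall fun ε t Φ₀ => (f.res_F _).trans ?_⟩
    refine VPresheaf.Hom.app_congr_of_le_sup P.F.isSheaf hNθ hV
      (hR.isLocal _ inf_le_left _ _ fun u => ?_)
    rw [e.res_pullback, hT _ inf_le_right]
  · exact ⟨κ.η.zeroLocus, κ.η.zeroLocus_le, U, _, hx0, IsBasicLocal.zero.smooth, .zero hB,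
      .of_res_eq fun _ => (f.res_F_zero _).trans (map_zero _).symm⟩

variable [LocallyCompactSpace X] [RegularSpace X]

theorem IsRestriction.dirBound_sub_app (hB : IsSolidClass B)
    (hU : U ≤ χ.η.idLocus ⊔ κ.η.zeroLocus) (hR : IsBasicLocal R) {R' : P.RO V → P.F.obj V}
    (hres : IsRestriction hV (TestPair.extendMap f e R) R')
    (hsmooth : IsSmoothMap (R' - fun Φ => κ.θ.app V hV (R Φ))) :
    DirBound S B (R' - fun Φ => κ.θ.app V hV (R Φ)) := by
  refine DirBound.of_locally_eq_zero hB hsmooth fun x hx => ?_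
  have hdiff {W : Opens X} (hW : RelCompact W V) {L : P.RO V →L[ℂ] P.RO U}
      (hL : ∀ Φ u, P.F.res hW.le (Φ (P.E.res hV u)) = P.F.res (hW.le.trans hV) (L Φ u))
      (Φ : P.RO V) : P.F.res hW.le ((R' - fun Φ => κ.θ.app V hV (R Φ)) Φ)
        = κ.θ.app W (hW.le.trans hV)
          (P.F.res hW.le (R (e.pullback (L Φ))) - P.F.res hW.le (R Φ)) := by
    rw [Pi.sub_apply, map_sub, map_sub, hres W hW hW.le _ _ (hL Φ), TestPair.extendMap,
      ← P.F.res_res hW.le hV, f.res_F, κ.θ.app_res, κ.θ.app_res]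
  rcases hU (hV hx) with hid | hzero
  · obtain ⟨W, hxW, hW⟩ := exists_relCompact_of_mem (U := V ⊓ χ.η.idLocus) ⟨hx, hid⟩
    obtain ⟨W₀, hWW₀, hW₀⟩ := hW.exists_between
    have hWV : RelCompact W V := hW.mono inf_le_left
    have hW₀V : RelCompact W₀ V := hW₀.mono inf_le_left
    obtain ⟨L, hL⟩ := exists_extendCLM (P := P) hV hWV
    refine ⟨W, hWV.le, hxW, fun Φ hΦ Ψ hΨ => ?_⟩
    filter_upwards [eventually_res_eq_of_mem_ROloc hΦ.2 hWW₀ hW₀V hWV.le,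
      eventually_res_eq_of_mem_ROloc hΨ.2 hWW₀ hW₀V hWV.le] with ε hΦε hΨε t
    rw [hdiff hWV hL, hR.isLocal W hWV.le _ (Φ ε + t • Ψ ε) fun u => ?_, sub_self, map_zero]
    have hu : P.E.res hW₀V.le (P.E.res hV (e.E u)) = P.E.res hW₀V.le u := by
      rw [e.res_E]
      exact (χ.η.isIdOn_idLocus P.E.isSheaf).res_app hV _ (hW₀.le.trans inf_le_right) u
    rw [e.res_pullback, ← hL, add_apply, add_apply, smul_apply, smul_apply, map_add, map_add,
      map_smul, map_smul, hΦε _ _ hu, hΨε _ _ hu]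
  · obtain ⟨W, hxW, hW⟩ := exists_relCompact_of_mem (U := V ⊓ κ.η.zeroLocus) ⟨hx, hzero⟩
    have hWV : RelCompact W V := hW.mono inf_le_left
    obtain ⟨L, hL⟩ := exists_extendCLM (P := P) hV hWV
    refine ⟨W, hWV.le, hxW, fun Φ _ Ψ _ => Eventually.of_forall fun ε t => ?_⟩
    rw [hdiff hWV hL, κ.θ_vanishesOn_zeroLocus _ _ (hW.le.trans inf_le_right)]

end Extension

theorem mem_Mloc_of_locally {R : P.RO U → P.F.obj U}
    (h : ∀ x ∈ U, ∃ (W : Opens X) (hW : W ≤ U) (R' : P.Mloc S U),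
      x ∈ W ∧ ∀ Φ, P.F.res hW (R Φ) = P.F.res hW (R'.1 Φ)) : R ∈ P.Mloc S U := by
  have hsmooth : IsSmoothMap R := fun c hc =>
    P.F.isSmoothCurve_of_locally fun x hx => by
      obtain ⟨W, hW, R', hxW, he⟩ := h x hx
      refine ⟨W, hW, hxW, ?_⟩
      simpa only [he, LCSheaf.resCLM_apply] using R'.2.1.smooth.clm_comp (P.F.resCLM hW) c hc
  refine mem_Mloc_iff_dirBound.2 ⟨⟨hsmooth, fun V hV Φ₁ Φ₂ hΦ => ?_⟩, ?_⟩
  · refine P.F.isSheaf.eq_of_locally fun x hx => ?_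
    obtain ⟨W, hW, R', hxW, he⟩ := h x (hV hx)
    refine ⟨V ⊓ W, inf_le_left, ⟨hx, hxW⟩, ?_⟩
    rw [P.F.res_res, P.F.res_res, P.F.res_congr hW inf_le_right (he Φ₁),
      P.F.res_congr hW inf_le_right (he Φ₂)]
    exact R'.2.1.isLocal _ _ _ _ fun u => P.F.res_congr hV inf_le_left (hΦ u)
  · refine DirBound.of_locally (isSolidClass_moderateClass S) hsmooth fun x hx => ?_
    obtain ⟨W, hW, R', hxW, he⟩ := h x hx
    exact ⟨W, hW, U, R'.1, hxW, R'.2.1.smooth, dirBound_of_mem_Mloc R', .of_res_eq he⟩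

theorem exists_locallyFinite_sum {ι : Type*} (T : ι → P.Mloc S U) (Z : ι → Opens X)
    (hZ : ∀ i, Z i ≤ U) (hT : ∀ i Φ, P.F.res (hZ i) ((T i).1 Φ) = 0)
    (hfin : ∀ x ∈ U, ∃ W : Opens X, x ∈ W ∧ W ≤ U ∧ ∃ J : Finset ι, ∀ i ∉ J, W ≤ Z i) :
    ∃ R : P.Mloc S U, ∀ (W : Opens X) (hW : W ≤ U) (J : Finset ι), (∀ i ∉ J, W ≤ Z i) →
      ∀ Φ, P.F.res hW (R.1 Φ) = P.F.res hW ((∑ i ∈ J, T i).1 Φ) := by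
  have hsum (J : Finset ι) (Φ : P.RO U) : (∑ i ∈ J, T i).1 Φ = ∑ i ∈ J, (T i).1 Φ := by
    rw [Submodule.coe_sum, Finset.sum_apply]
  choose R hR using fun Φ =>
    P.F.isSheaf.exists_locallyFinite_sum (fun i => (T i).1 Φ) Z hZ (fun i => hT i Φ) hfin
  simp only [← hsum] at hR
  refine ⟨⟨R, mem_Mloc_of_locally fun x hx => ?_⟩, fun W hW J hJ Φ => hR Φ W hW J hJ⟩
  obtain ⟨W, hxW, hW, J, hJ⟩ := hfin x hx
  exact ⟨W, hW, _, hxW, fun Φ => hR Φ W hW J hJ⟩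

namespace GlocPresheaf

variable [LocallyCompactSpace X] [RegularSpace X] (G : P.GlocPresheaf S)

theorem exists_extension (hTO : ∀ U : Opens X, (P.TOloc S U).Nonempty) (κ : P.EndPair U)
    (hV : V ≤ U) (hU : U ≤ V ⊔ κ.η.zeroLocus) (g : P.Gloc S V) :
    ∃ T : P.Mloc S U, (∀ Φ, P.F.res κ.η.zeroLocus_le (T.1 Φ) = 0) ∧
      G.res hV (cls T) = (G.endHom κ.contF).app V hV g := by
  obtain ⟨R, rfl⟩ := exists_cls_eq g
  obtain ⟨χ, hχ, hχV⟩ := exists_cutoff (P := P) hV κ.η.zeroLocus_le hU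
  obtain ⟨f⟩ := κ.exists_extension hV hU
  obtain ⟨e⟩ := χ.exists_extension hV hχV
  let T : P.Mloc S U := ⟨extendMap f e R.1, mem_Mloc_iff_dirBound.2 ⟨R.2.1.extendMap f e,
    .extendMap f e (isSolidClass_moderateClass S) (hTO V) hχ R.2.1 (dirBound_of_mem_Mloc R)⟩⟩
  obtain ⟨T', hT', he⟩ := G.res_mk hV T
  refine ⟨T, fun Φ => f.res_F_zero _, he.trans ?_⟩
  exact cls_eq_cls_iff.2 <| hT'.dirBound_sub_app f e (isSolidClass_negligibleClass S) hχ R.2.1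
    (T' - endM κ.contF hV R).2.1.smooth

variable {G} in
theorem res_eq_endHom_app (hTO : ∀ U : Opens X, (P.TOloc S U).Nonempty) {κ : P.EndPair U}
    {hV : V ≤ U} (hU : U ≤ V ⊔ κ.η.zeroLocus) {T : P.Mloc S U} {g : P.Gloc S V}
    (hT₀ : ∀ Φ, P.F.res κ.η.zeroLocus_le (T.1 Φ) = 0)
    (hT : G.res hV (cls T) = (G.endHom κ.contF).app V hV g) (hW : W ≤ U) {g' : P.Gloc S W}
    (h : G.res (inf_le_left : V ⊓ W ≤ V) g = G.res (inf_le_right : V ⊓ W ≤ W) g') :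
    G.res hW (cls T) = (G.endHom κ.contF).app W hW g' := by
  refine G.eq_of_locally hTO fun x hx => ?_
  rcases hU (hW hx) with hxV | hxZ
  · refine ⟨V ⊓ W, inf_le_right, ⟨hxV, hx⟩, ?_⟩
    rw [G.res_res, ← G.res_res inf_le_left hV, hT, ← G.endHom_app_res, ← G.endHom_app_res, h]
  · refine ⟨κ.η.zeroLocus ⊓ W, inf_le_right, ⟨hxZ, hx⟩, ?_⟩
    have hres : G.res (inf_le_right : κ.η.zeroLocus ⊓ W ≤ W) (G.res hW (cls T)) = 0 := by
      have hT0 : G.res κ.η.zeroLocus_le (cls T) = G.res κ.η.zeroLocus_le (cls 0) :=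
        G.res_cls_congr _ fun Φ => (hT₀ Φ).trans (map_zero _).symm
      rw [G.res_res, ← G.res_res inf_le_left κ.η.zeroLocus_le, hT0, cls, map_zero, map_zero,
        map_zero]
    exact hres.trans ((G.endHom_vanishesOn κ.contF κ.θ_vanishesOn_zeroLocus).res_app hW
      inf_le_right inf_le_left g').symm

theorem exists_gluing (hTO : ∀ U : Opens X, (P.TOloc S U).Nonempty) {ι : Type u}
    {c : ι → Opens X} (hc : ∀ i, c i ≤ U) (hcov : U ≤ ⨆ i, c i) (s : ∀ i, P.Gloc S (c i))
    (hs : ∀ i j, G.res (inf_le_left : c i ⊓ c j ≤ c i) (s i)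
      = G.res (inf_le_right : c i ⊓ c j ≤ c j) (s j)) :
    ∃ g : P.Gloc S U, ∀ i, G.res (hc i) g = s i := by
  obtain ⟨κ, hκ⟩ := exists_endPair_partition (P := P) hc hcov
  have hU i : U ≤ c i ⊔ (κ i).η.zeroLocus := VPresheaf.Hom.le_sup_zeroLocus (hκ.support_subset i)
  choose T hT₀ hT using fun i => G.exists_extension hTO (κ i) (hc i) (hU i) (s i)
  obtain ⟨R, hR⟩ := exists_locallyFinite_sum T _ _ hT₀ fun _ hx => hκ.exists_finset hx
  refine ⟨cls R, fun j => G.eq_of_locally hTO fun x hx => ?_⟩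
  obtain ⟨W, hxW, hW, J, hJ⟩ := hκ.exists_finset (hc j hx)
  have hjU : c j ⊓ W ≤ U := inf_le_right.trans hW
  have hJW : ∀ i ∉ J, c j ⊓ W ≤ (κ i).η.zeroLocus := fun i hi => inf_le_right.trans (hJ i hi)
  refine ⟨c j ⊓ W, inf_le_left, ⟨hx, hxW⟩, ?_⟩
  have hterm i : G.res hjU (cls (T i))
      = (G.endHom (κ i).contF).app (c j ⊓ W) hjU (G.res inf_le_left (s j)) :=
    res_eq_endHom_app hTO (hU i) (hT₀ i) (hT i) hjU <| by
      rw [G.res_res, ← G.res_res (le_inf inf_le_left (inf_le_right.trans inf_le_left) :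
        c i ⊓ (c j ⊓ W) ≤ c i ⊓ c j) inf_le_left, hs i j, G.res_res]
  have hsum : G.res inf_le_left (G.res (hc j) (cls R)) = ∑ i ∈ J, G.res hjU (cls (T i)) := by
    rw [G.res_res, G.res_cls_congr hjU (hR _ hjU J hJW), cls, map_sum, map_sum]
    rfl
  exact hsum.trans <| (Finset.sum_congr rfl fun i _ => hterm i).trans <|
    G.sum_endHom_app (fun i => (κ i).contF) hjU J (EndPair.sum_θ_app hκ hjU hJW) _

theorem isSheaf (hTO : ∀ U : Opens X, (P.TOloc S U).Nonempty) : G.toVPresheaf.IsSheaf := by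
  refine fun U ι c hc hcov => ⟨fun g hg => G.eq_of_locally hTO fun x hx => ?_,
    G.exists_gluing hTO hc hcov⟩
  obtain ⟨i, hi⟩ := Opens.mem_iSup.1 (hcov hx)
  exact ⟨c i, hc i, hi, (hg i).trans (map_zero (G.res (hc i))).symm⟩

theorem isFineOn (U : Opens X) : G.toVPresheaf.IsFineOn U := by
  intro A B hA hB hAB
  have exists_compl {C : Set U} (hC : IsClosed C) :
      ∃ V : Opens X, V ≤ U ∧ ∀ x : U, x.1 ∈ V ↔ x ∉ C :=
    ⟨⟨Subtype.val '' Cᶜ, U.isOpen.isOpenMap_subtype_val _ hC.isOpen_compl⟩,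
      Subtype.coe_image_subset _ _, fun _ => Subtype.val_injective.mem_set_image⟩
  obtain ⟨Z, hZ, mem_Z⟩ := exists_compl hA
  obtain ⟨V, hV, mem_V⟩ := exists_compl hB
  have hU : U ≤ V ⊔ Z := fun x hx => (em (⟨x, hx⟩ ∈ A)).imp
    (fun h => (mem_V ⟨x, hx⟩).2 (hAB.notMem_of_mem_left h)) (mem_Z ⟨x, hx⟩).2
  obtain ⟨κ, hid, hzero⟩ := exists_cutoff (P := P) hV hZ hU
  refine ⟨G.endHom κ.contF, κ.η.idLocus, κ.η.zeroLocus, κ.η.idLocus_le, κ.η.zeroLocus_le, ?_, ?_,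
    G.endHom_isIdOn _ κ.θ_isIdOn_idLocus, G.endHom_vanishesOn _ κ.θ_vanishesOn_zeroLocus⟩
  · rintro _ ⟨x, hx, rfl⟩
    exact (hid x.2).resolve_right fun h => (mem_Z x).1 h hx
  · rintro _ ⟨x, hx, rfl⟩
    exact (hzero x.2).resolve_left fun h => (mem_V x).1 h hx

theorem hasPartitionsOfUnityOn (hTO : ∀ U : Opens X, (P.TOloc S U).Nonempty) (U : Opens X) :
    G.toVPresheaf.HasPartitionsOfUnityOn U := by
  intro ι c hc hcov
  obtain ⟨κ, hκ⟩ := exists_endPair_partition (P := P) hc hcov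
  have hvan i : (G.endHom (κ i).contF).VanishesOn (κ i).η.zeroLocus :=
    G.endHom_vanishesOn _ (κ i).θ_vanishesOn_zeroLocus
  refine ⟨fun i => G.endHom (κ i).contF, .of_locally (G.isSheaf hTO)
    (fun i => VPresheaf.Hom.support_subset_of_le_sup
      (VPresheaf.Hom.le_sup_zeroLocus (hκ.support_subset i)) (κ i).η.zeroLocus_le (hvan i))
    fun x hx => ?_⟩
  obtain ⟨W, hxW, hW, J, hJ⟩ := hκ.exists_finset hx
  refine ⟨W, hxW, hW, J, fun i hi => (hvan i).mono (hJ i hi), fun V hV hVW => ?_⟩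
  exact G.sum_endHom_app (fun i => (κ i).contF) hV J <| EndPair.sum_θ_app hκ hV fun i hi =>
    hVW.trans (hJ i hi)

end GlocPresheaf

/-! ## The embedding of `F` -/

theorem sigma_injective (hU : (P.TOloc S U).Nonempty) : Function.Injective (P.sigma S U) := by
  refine (injective_iff_map_eq_zero _).2 fun φ hφ => by_contra fun hne => ?_
  obtain ⟨q, hq⟩ :=
    (PolynormableSpace.withSeminorms ℂ (P.F.obj U)).separating_of_T1 φ hne
  obtain ⟨Φ, hΦ⟩ := hU
  obtain ⟨m, hm, hlim⟩ := S.I_lim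
  have hneg : (fun _ => φ : P.RO U → P.F.obj U) ∈ P.Nloc S U :=
    (Submodule.Quotient.mk_eq_zero ((P.Nloc S U).submoduleOf (P.Mloc S U))).1 hφ
  have hbd := (mem_Nloc_iff_dirBound.1 hneg).2 q.1 q.2 0 Φ hΦ 0 zero_mem_TOzloc m hm
  simp only [dirDeriv_zero] at hbd
  exact hq <| tendsto_nhds_unique tendsto_const_nhds <|
    IsBigO.trans_tendsto hbd (by simpa using NNReal.tendsto_coe.2 hlim)

theorem GlocPresheaf.res_sigma [LocallyCompactSpace X] [RegularSpace X] (G : P.GlocPresheaf S)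
    (hV : V ≤ U) (φ : P.F.obj U) : G.res hV (P.sigma S U φ) = P.sigma S V (P.F.res hV φ) :=
  G.res_cls (R := ⟨fun _ => φ, IsBasicLocal.const φ, IsModerate.const S φ⟩)
    (R' := ⟨fun _ => P.F.res hV φ, IsBasicLocal.const _, IsModerate.const S _⟩)
    fun _ _ hW _ _ _ => P.F.res_res hW hV φ

/-! ## Products -/

theorem mul_mem_moderateClass {f g : Param → ℝ} (hf : f ∈ moderateClass S)
    (hg : g ∈ moderateClass S) : f * g ∈ moderateClass S := by
  obtain ⟨l, hl, hf⟩ := hf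
  obtain ⟨m, hm, hg⟩ := hg
  obtain ⟨n, hn, h⟩ := S.A_mul l hl m hm
  exact ⟨n, hn, (IsBigO.mul hf hg).trans h⟩

theorem mul_mem_negligibleClass {f g : Param → ℝ} (hf : f ∈ moderateClass S)
    (hg : g ∈ negligibleClass S) : f * g ∈ negligibleClass S := by
  obtain ⟨l, hl, hf⟩ := hf
  intro m hm
  obtain ⟨n, hn, h⟩ := S.A_mul_I m hm l hl
  exact (IsBigO.mul hf (hg n hn)).trans h

theorem DirBound.bilinear {B : P.F.obj U →ₗ[ℂ] P.F.obj U →ₗ[ℂ] P.F.obj U}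
    {C C₁ C₂ : Set (Param → ℝ)} (hC : IsSolidClass C)
    (hmul : ∀ {f g : Param → ℝ}, f ∈ C₁ → g ∈ C₂ → f * g ∈ C)
    (hB : Continuous fun x : P.F.obj U × P.F.obj U => B x.1 x.2) {R₁ R₂ : P.RO U → P.F.obj U}
    (h₁ : IsSmoothMap R₁) (h₂ : IsSmoothMap R₂) (hb₁ : DirBound S C₁ R₁)
    (hb₂ : DirBound S C₂ R₂) : DirBound S C fun Φ => B (R₁ Φ) (R₂ Φ) := by
  intro p hp l Φ hΦ Ψ hΨ
  obtain ⟨q₁, q₂, hq₁, hq₂, hpB⟩ := exists_seminorm_bilinear_le B hB p hp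
  have hterm (ij : ℕ × ℕ) := hC.const_mul_mem
    (hmul (hb₁ q₁ hq₁ ij.1 Φ hΦ Ψ hΨ) (hb₂ q₂ hq₂ ij.2 Φ hΦ Ψ hΨ)) (l.choose ij.1)
  refine hC.of_le (hC.sum_mem (Finset.HasAntidiagonal.antidiagonal l) fun ij _ => hterm ij)
    (fun _ => apply_nonneg _ _) (Eventually.of_forall fun ε => ?_)
  rw [dirDeriv_bilinear hB h₁ h₂, Finset.sum_apply]
  refine (Finset.le_sum_of_subadditive p (map_zero p).le (map_add_le_add p) _ _).trans
    (Finset.sum_le_sum fun ij _ => ?_)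
  rw [← Nat.cast_smul_eq_nsmul ℂ, map_smul_eq_mul, Complex.norm_natCast]
  exact mul_le_mul_of_nonneg_left (hpB _ _) (Nat.cast_nonneg _)

section Algebra

variable (a : P.F.toVPresheaf.AlgebraStructure) (ha : LCSheaf.IsJointlyContinuous a)

/-- The pointwise product of moderate local maps. -/
def mulM (U : Opens X) : P.Mloc S U →ₗ[ℂ] P.Mloc S U →ₗ[ℂ] P.Mloc S U :=
  LinearMap.mk₂ ℂ
    (fun R₁ R₂ => ⟨fun Φ => a.mul U (R₁.1 Φ) (R₂.1 Φ), mem_Mloc_iff_dirBound.2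
      ⟨⟨R₁.2.1.smooth.bilinear (ha U) R₂.2.1.smooth, fun V hV Φ₁ Φ₂ hΦ => by
        rw [a.res_mul, a.res_mul, R₁.2.1.isLocal V hV Φ₁ Φ₂ hΦ, R₂.2.1.isLocal V hV Φ₁ Φ₂ hΦ]⟩,
      .bilinear (isSolidClass_moderateClass S) mul_mem_moderateClass (ha U) R₁.2.1.smooth
        R₂.2.1.smooth (dirBound_of_mem_Mloc R₁) (dirBound_of_mem_Mloc R₂)⟩⟩)
    (fun R R' R₂ => Subtype.ext <| funext fun Φ =>
      LinearMap.map_add₂ (a.mul U) (R.1 Φ) (R'.1 Φ) (R₂.1 Φ))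
    (fun c R R₂ => Subtype.ext <| funext fun Φ => LinearMap.map_smul₂ (a.mul U) c (R.1 Φ) (R₂.1 Φ))
    (fun R₁ R R' => Subtype.ext <| funext fun Φ => map_add (a.mul U (R₁.1 Φ)) (R.1 Φ) (R'.1 Φ))
    (fun c R₁ R => Subtype.ext <| funext fun Φ => map_smul (a.mul U (R₁.1 Φ)) c (R.1 Φ))

theorem mulM_comm (R₁ R₂ : P.Mloc S U) : mulM a ha U R₁ R₂ = mulM a ha U R₂ R₁ :=
  Subtype.ext <| funext fun _ => a.mul_comm U _ _

theorem IsRestriction.mulM {hV : V ≤ U} {R₁ R₂ : P.Mloc S U} {R₁' R₂' : P.Mloc S V}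
    (h₁ : IsRestriction hV R₁.1 R₁'.1) (h₂ : IsRestriction hV R₂.1 R₂'.1) :
    IsRestriction hV (mulM a ha U R₁ R₂).1 (mulM a ha V R₁' R₂').1 := by
  intro W hWc hW Φ Φ' hΦ
  change P.F.res hW (a.mul V _ _) = P.F.res _ (a.mul U _ _)
  rw [a.res_mul, a.res_mul, h₁ W hWc hW Φ Φ' hΦ, h₂ W hWc hW Φ Φ' hΦ]

theorem mulM_mem_Nloc (R₁ : P.Mloc S U) {R₂ : P.Mloc S U} (h : R₂.1 ∈ P.Nloc S U) :
    (mulM a ha U R₁ R₂).1 ∈ P.Nloc S U :=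
  mem_Nloc_iff_dirBound.2 ⟨(mulM a ha U R₁ R₂).2.1,
    .bilinear (isSolidClass_negligibleClass S) mul_mem_negligibleClass (ha U) R₁.2.1.smooth
      R₂.2.1.smooth (dirBound_of_mem_Mloc R₁) (mem_Nloc_iff_dirBound.1 h).2⟩

/-- The product of `𝒢_loc(U)`. -/
def mulG (U : Opens X) : P.Gloc S U →ₗ[ℂ] P.Gloc S U →ₗ[ℂ] P.Gloc S U :=
  Submodule.liftQ _
    { toFun R := Submodule.mapQ _ _ (mulM a ha U R) fun _ h => mulM_mem_Nloc a ha R h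
      map_add' R R' := LinearMap.ext fun g => by
        obtain ⟨R₂, rfl⟩ := exists_cls_eq g
        exact congrArg cls (LinearMap.map_add₂ (mulM a ha U) R R' R₂)
      map_smul' c R := LinearMap.ext fun g => by
        obtain ⟨R₂, rfl⟩ := exists_cls_eq g
        exact congrArg cls (LinearMap.map_smul₂ (mulM a ha U) c R R₂) }
    fun R hR => LinearMap.ext fun g => by
      obtain ⟨R₂, rfl⟩ := exists_cls_eq g
      refine (Submodule.Quotient.mk_eq_zero _).2 ?_
      rw [mulM_comm]
      exact mulM_mem_Nloc a ha R₂ hR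

theorem mulG_cls (R₁ R₂ : P.Mloc S U) :
    mulG a ha U (cls R₁) (cls R₂) = cls (mulM a ha U R₁ R₂) := rfl

theorem mulG_sigma_one {e : P.F.obj U} (he : ∀ φ, a.mul U e φ = φ) (g : P.Gloc S U) :
    mulG a ha U (P.sigma S U e) g = g := by
  obtain ⟨R, rfl⟩ := exists_cls_eq g
  exact congrArg cls (Subtype.ext (funext fun Φ => he _) :
    mulM a ha U ⟨fun _ => e, IsBasicLocal.const e, IsModerate.const S e⟩ R = R)

variable [LocallyCompactSpace X] [RegularSpace X]

/-- The algebra structure of `𝒢_loc` given by `[R₁] · [R₂] = [R₁ · R₂]`. -/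
def GlocPresheaf.algebraStructure (G : P.GlocPresheaf S) : G.toVPresheaf.AlgebraStructure where
  mul U := mulG a ha U
  mul_comm U g₁ g₂ := by
    obtain ⟨R₁, rfl⟩ := exists_cls_eq g₁
    obtain ⟨R₂, rfl⟩ := exists_cls_eq g₂
    exact congrArg cls (mulM_comm a ha R₁ R₂)
  mul_assoc U g₁ g₂ g₃ := by
    obtain ⟨R₁, rfl⟩ := exists_cls_eq g₁
    obtain ⟨R₂, rfl⟩ := exists_cls_eq g₂
    obtain ⟨R₃, rfl⟩ := exists_cls_eq g₃
    exact congrArg cls (Subtype.ext <| funext fun Φ => a.mul_assoc U _ _ _ :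
      mulM a ha U (mulM a ha U R₁ R₂) R₃ = mulM a ha U R₁ (mulM a ha U R₂ R₃))
  res_mul {U V} hV g₁ g₂ := by
    obtain ⟨R₁, rfl⟩ := exists_cls_eq g₁
    obtain ⟨R₂, rfl⟩ := exists_cls_eq g₂
    obtain ⟨R₁', h₁, he₁⟩ := G.res_mk hV R₁
    obtain ⟨R₂', h₂, he₂⟩ := G.res_mk hV R₂
    change G.res hV (cls _) = mulG a ha V (G.res hV (cls R₁)) (G.res hV (cls R₂))
    rw [he₁, he₂, mulG_cls]
    exact G.res_cls (h₁.mulM a ha h₂)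

end Algebra

end TestPair

end NonlinearExtension

end

open NonlinearExtension TestPair in
theorem mainTheorem6_general {X : Type u} [TopologicalSpace X] [RegularSpace X]
    [LocallyCompactSpace X] (P : TestPair.{u, v, w} X) (S : ScalePair)
    (hTO : ∀ U : Opens X, (P.TOloc S U).Nonempty) :
    (∀ (U V : Opens X) (h : V ≤ U) (R : P.RO U → P.F.obj U), IsBasicLocal R →
      ∃! R' : P.RO V → P.F.obj V, IsBasicLocal R' ∧ IsRestriction h R R') ∧
    ∃ G : P.GlocPresheaf S, (∀ G' : P.GlocPresheaf S, G' = G) ∧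
      G.toVPresheaf.IsSheaf ∧
      (∀ U : Opens X, G.toVPresheaf.IsFineOn U ∧ G.toVPresheaf.HasPartitionsOfUnityOn U) ∧
      (∀ (U : Opens X) (T : P.F.EndOn U), LCSheaf.IsContinuous T →
        ∃ T' : VPresheaf.Hom G.toVPresheaf G.toVPresheaf U,
          (∀ (V : Opens X) (hV : V ≤ U) (R : P.Mloc S V), ∃ R' : P.Mloc S V,
            (∀ Φ : P.RO V, R'.1 Φ = T.app V hV (R.1 Φ)) ∧ T'.app V hV (cls R) = cls R') ∧
          (∀ (V : Opens X) (hV : V ≤ U) (φ : P.F.obj V),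
            T'.app V hV (P.sigma S V φ) = P.sigma S V (T.app V hV φ)) ∧
          ∀ W : Opens X, W ≤ U →
            (T.IsIdOn W → T'.IsIdOn W) ∧ (T.VanishesOn W → T'.VanishesOn W)) ∧
      (∀ U : Opens X, Function.Injective (P.sigma S U)) ∧
      (∀ (U V : Opens X) (h : V ≤ U) (φ : P.F.obj U),
        G.res h (P.sigma S U φ) = P.sigma S V (P.F.res h φ)) ∧
      ∀ a : P.F.toVPresheaf.AlgebraStructure, LCSheaf.IsJointlyContinuous a →
        ∃ b : G.toVPresheaf.AlgebraStructure,
          (∀ (U : Opens X) (R₁ R₂ : P.Mloc S U), ∃ R : P.Mloc S U,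
            (∀ Φ : P.RO U, R.1 Φ = a.mul U (R₁.1 Φ) (R₂.1 Φ)) ∧
            b.mul U (cls R₁) (cls R₂) = cls R) ∧
          (∀ (U : Opens X) (φ ψ : P.F.obj U),
            P.sigma S U (a.mul U φ ψ) = b.mul U (P.sigma S U φ) (P.sigma S U ψ)) ∧
          ∀ (U : Opens X) (e : P.F.obj U), (∀ φ : P.F.obj U, a.mul U e φ = φ) →
            ∀ g : P.Gloc S U, b.mul U (P.sigma S U e) g = g := by
  obtain ⟨G⟩ : Nonempty (P.GlocPresheaf S) := ⟨glocPresheaf hTO⟩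
  refine ⟨fun U V h R hR => ?_, G, fun G' => G'.eq _, ?_, fun U => ⟨?_, ?_⟩,
    fun U T hT => ⟨G.endHom hT, fun V hV R => ⟨endM hT hV R, fun _ => rfl, rfl⟩,
      fun V hV φ => rfl, fun W _ => ⟨?_, ?_⟩⟩, fun U => ?_, fun U V h φ => ?_, fun a ha => ?_⟩
  · obtain ⟨R', hR', hres⟩ := hR.exists_restriction h
    exact ⟨R', ⟨hR', hres⟩, fun R'' h'' => h''.2.eq hres⟩
  · exact G.isSheaf hTO
  · exact G.isFineOn U
  · exact G.hasPartitionsOfUnityOn hTO U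
  · exact G.endHom_isIdOn hT
  · exact G.endHom_vanishesOn hT
  · exact sigma_injective (hTO U)
  · exact G.res_sigma h φ
  · exact ⟨G.algebraStructure a ha, fun U R₁ R₂ => ⟨_, fun _ => rfl, rfl⟩, fun U φ ψ => rfl,
      fun U e he g => mulG_sigma_one a ha he g⟩

theorem mainTheorem6 {X : Type u} [TopologicalSpace X] [T2Space X] [LocallyCompactSpace X]
    [ParacompactSpace X] (P : NonlinearExtension.TestPair.{u, v, w} X)
    (S : NonlinearExtension.ScalePair) (hTO : ∀ U : Opens X, (P.TOloc S U).Nonempty) :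
    -- the restriction maps on local elements of the basic space are well defined
    (∀ (U V : Opens X) (h : V ≤ U) (R : P.RO U → P.F.obj U),
      NonlinearExtension.TestPair.IsBasicLocal R →
      ∃! R' : P.RO V → P.F.obj V, NonlinearExtension.TestPair.IsBasicLocal R' ∧
        NonlinearExtension.TestPair.IsRestriction h R R') ∧
    -- they induce a unique presheaf structure on the quotients
    ∃ G : P.GlocPresheaf S, (∀ G' : P.GlocPresheaf S, G' = G) ∧
      -- which is a sheaf
      G.toVPresheaf.IsSheaf ∧
      -- whose restriction to every open set is fine
      (∀ U : Opens X, G.toVPresheaf.IsFineOn U ∧ G.toVPresheaf.HasPartitionsOfUnityOn U) ∧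
      -- morphisms of `F|_U` extend to `G|_U`; cut-off morphisms extend to cut-off morphisms
      (∀ (U : Opens X) (T : P.F.EndOn U), NonlinearExtension.LCSheaf.IsContinuous T →
        ∃ T' : NonlinearExtension.VPresheaf.Hom G.toVPresheaf G.toVPresheaf U,
          (∀ (V : Opens X) (hV : V ≤ U) (R : P.Mloc S V), ∃ R' : P.Mloc S V,
            (∀ Φ : P.RO V, R'.1 Φ = T.app V hV (R.1 Φ)) ∧
            T'.app V hV (NonlinearExtension.TestPair.cls R) =
              NonlinearExtension.TestPair.cls R') ∧
          (∀ (V : Opens X) (hV : V ≤ U) (φ : P.F.obj V),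
            T'.app V hV (P.sigma S V φ) = P.sigma S V (T.app V hV φ)) ∧
          ∀ W : Opens X, W ≤ U →
            (T.IsIdOn W → T'.IsIdOn W) ∧ (T.VanishesOn W → T'.VanishesOn W)) ∧
      -- `σ` is an injective sheaf morphism
      (∀ U : Opens X, Function.Injective (P.sigma S U)) ∧
      (∀ (U V : Opens X) (h : V ≤ U) (φ : P.F.obj U),
        G.res h (P.sigma S U φ) = P.sigma S V (P.F.res h φ)) ∧
      -- if `F` is a locally convex sheaf of algebras, then `G` is a sheaf of algebras with the
      -- product `[R₁] [R₂] = [R₁ R₂]`, and `σ` is an algebra homomorphism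
      ∀ a : P.F.toVPresheaf.AlgebraStructure, NonlinearExtension.LCSheaf.IsJointlyContinuous a →
        ∃ b : G.toVPresheaf.AlgebraStructure,
          (∀ (U : Opens X) (R₁ R₂ : P.Mloc S U), ∃ R : P.Mloc S U,
            (∀ Φ : P.RO U, R.1 Φ = a.mul U (R₁.1 Φ) (R₂.1 Φ)) ∧
            b.mul U (NonlinearExtension.TestPair.cls R₁) (NonlinearExtension.TestPair.cls R₂) =
              NonlinearExtension.TestPair.cls R) ∧
          (∀ (U : Opens X) (φ ψ : P.F.obj U),
            P.sigma S U (a.mul U φ ψ) = b.mul U (P.sigma S U φ) (P.sigma S U ψ)) ∧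
          ∀ (U : Opens X) (e : P.F.obj U), (∀ φ : P.F.obj U, a.mul U e φ = φ) →
            ∀ g : P.Gloc S U, b.mul U (P.sigma S U e) g = g :=
  mainTheorem6_general P S hTO
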